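/- Let $\Bbbk$ be a field of characteristic $0$, let $q$ be transcendental over $\Bbbk$, and let $F=\Bbbk(q)$ be the field of fractions of $\Bbbk[q,q^{-1}]$. Let $U_q=U_q(\mathfrak{sl}(2|1))$ be the associative unital $F$-algebra generated by $k_1^{\pm1},k_2^{\pm1},e_1,e_2,f_1,f_2$ subject to the relations \[ k_1k_1^{-1}=k_1^{-1}k_1=1,\quad k_2k_2^{-1}=k_2^{-1}k_2=1,\quad k_2k_1=k_1k_2, \] \[ e_1k_1=q^{-2}k_1e_1,\quad e_2k_1=qk_1e_2,\quad e_1k_2=qk_2e_1,\quad e_2k_2=k_2e_2, \] \[ k_1f_1=q^{-2}f_1k_1,\quad k_1f_2=qf_2k_1,\quad k_2f_1=qf_1k_2,\quad k_2f_2=f_2k_2, \] \[ e_1f_1=f_1e_1+\frac{k_1-k_1^{-1}}{q-q^{-1}},\quad e_2f_2=-f_2e_2+\frac{k_2-k_2^{-1}}{q-q^{-1}}, \] \[ e_1f_2=f_2e_1,\quad e_2f_1=f_1e_2,\quad e_2^2=f_2^2=0, \] \[ e_1^2e_2-(q+q^{-1})e_1e_2e_1+e_2e_1^2=0,\quad f_1^2f_2-(q+q^{-1})f_1f_2f_1+f_2f_1^2=0,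 \] and put $e_3:=e_1e_2-q^{-1}e_2e_1$ and $f_3:=f_2f_1-qf_1f_2$. Then the ordered monomials \[ f_1^w f_3^s f_2^l k_1^i k_2^j e_1^r e_3^h e_2^t,\qquad i,j\in\mathbb{Z},\ w,r\in\mathbb{Z}_{\ge 0},\ l,s,t,h\in\{0,1\}, \] are pairwise distinct and form a basis of $U_q$ as a vector space over $F$. -/

import Mathlib

namespace QuantumSl21

/-- The generators `k₁, k₁⁻¹, k₂, k₂⁻¹, e₁, e₂, f₁, f₂` of `U_q(sl(2|1))`. -/
inductive Gen : Type
  | k₁ | k₁inv | k₂ | k₂inv | e₁ | e₂ | f₁ | f₂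

/-- A generator, viewed in the free unital associative `F`-algebra on all the generators. -/
abbrev gen (F : Type*) [Field F] (x : Gen) : FreeAlgebra F Gen := FreeAlgebra.ι F x

/-- The defining relations of `U_q(sl(2|1))` over a field `F` with parameter `q`. -/
inductive Rel (F : Type*) [Field F] (q : F) : FreeAlgebra F Gen → FreeAlgebra F Gen → Prop
  | k₁_mul_inv : Rel F q (gen F .k₁ * gen F .k₁inv) 1
  | k₁_inv_mul : Rel F q (gen F .k₁inv * gen F .k₁) 1
  | k₂_mul_inv : Rel F q (gen F .k₂ * gen F .k₂inv) 1
  | k₂_inv_mul : Rel F q (gen F .k₂inv * gen F .k₂) 1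
  | k₂_k₁ : Rel F q (gen F .k₂ * gen F .k₁) (gen F .k₁ * gen F .k₂)
  | e₁_k₁ : Rel F q (gen F .e₁ * gen F .k₁) ((q⁻¹ ^ 2) • (gen F .k₁ * gen F .e₁))
  | e₂_k₁ : Rel F q (gen F .e₂ * gen F .k₁) (q • (gen F .k₁ * gen F .e₂))
  | e₁_k₂ : Rel F q (gen F .e₁ * gen F .k₂) (q • (gen F .k₂ * gen F .e₁))
  | e₂_k₂ : Rel F q (gen F .e₂ * gen F .k₂) (gen F .k₂ * gen F .e₂)
  | k₁_f₁ : Rel F q (gen F .k₁ * gen F .f₁) ((q⁻¹ ^ 2) • (gen F .f₁ * gen F .k₁))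
  | k₁_f₂ : Rel F q (gen F .k₁ * gen F .f₂) (q • (gen F .f₂ * gen F .k₁))
  | k₂_f₁ : Rel F q (gen F .k₂ * gen F .f₁) (q • (gen F .f₁ * gen F .k₂))
  | k₂_f₂ : Rel F q (gen F .k₂ * gen F .f₂) (gen F .f₂ * gen F .k₂)
  | e₁_f₁ : Rel F q (gen F .e₁ * gen F .f₁)
      (gen F .f₁ * gen F .e₁ + (q - q⁻¹)⁻¹ • (gen F .k₁ - gen F .k₁inv))
  | e₂_f₂ : Rel F q (gen F .e₂ * gen F .f₂)
      (-(gen F .f₂ * gen F .e₂) + (q - q⁻¹)⁻¹ • (gen F .k₂ - gen F .k₂inv))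
  | e₁_f₂ : Rel F q (gen F .e₁ * gen F .f₂) (gen F .f₂ * gen F .e₁)
  | e₂_f₁ : Rel F q (gen F .e₂ * gen F .f₁) (gen F .f₁ * gen F .e₂)
  | e₂_sq : Rel F q (gen F .e₂ ^ 2) 0
  | f₂_sq : Rel F q (gen F .f₂ ^ 2) 0
  | e_serre : Rel F q
      (gen F .e₁ ^ 2 * gen F .e₂ - (q + q⁻¹) • (gen F .e₁ * gen F .e₂ * gen F .e₁)
        + gen F .e₂ * gen F .e₁ ^ 2) 0
  | f_serre : Rel F q
      (gen F .f₁ ^ 2 * gen F .f₂ - (q + q⁻¹) • (gen F .f₁ * gen F .f₂ * gen F .f₁)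
        + gen F .f₂ * gen F .f₁ ^ 2) 0

/-- The unital associative `F`-algebra `U_q = U_q(sl(2|1))`, by generators and relations. -/
def Uq (F : Type*) [Field F] (q : F) : Type _ := RingQuot (Rel F q)

noncomputable section

instance (F : Type*) [Field F] (q : F) : Ring (Uq F q) :=
  inferInstanceAs (Ring (RingQuot (Rel F q)))

instance (F : Type*) [Field F] (q : F) : Algebra F (Uq F q) :=
  inferInstanceAs (Algebra F (RingQuot (Rel F q)))

namespace Uq

variable {F : Type*} [Field F]

/-- The canonical projection of the free algebra onto `U_q`. -/
def proj (q : F) : FreeAlgebra F Gen →ₐ[F] Uq F q := RingQuot.mkAlgHom F (Rel F q)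

theorem proj_eq_of_rel (q : F) {x y : FreeAlgebra F Gen} (h : Rel F q x y) :
    proj q x = proj q y := RingQuot.mkAlgHom_rel F h

/-- `k₁` as an invertible element of `U_q`, so that `k₁ ^ i` makes sense for `i : ℤ`. -/
def k₁ (q : F) : (Uq F q)ˣ where
  val := proj q (gen F .k₁)
  inv := proj q (gen F .k₁inv)
  val_inv := by rw [← map_mul, proj_eq_of_rel q .k₁_mul_inv, map_one]
  inv_val := by rw [← map_mul, proj_eq_of_rel q .k₁_inv_mul, map_one]

/-- `k₂` as an invertible element of `U_q`. -/
def k₂ (q : F) : (Uq F q)ˣ where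
  val := proj q (gen F .k₂)
  inv := proj q (gen F .k₂inv)
  val_inv := by rw [← map_mul, proj_eq_of_rel q .k₂_mul_inv, map_one]
  inv_val := by rw [← map_mul, proj_eq_of_rel q .k₂_inv_mul, map_one]

def e₁ (q : F) : Uq F q := proj q (gen F .e₁)
def e₂ (q : F) : Uq F q := proj q (gen F .e₂)
def f₁ (q : F) : Uq F q := proj q (gen F .f₁)
def f₂ (q : F) : Uq F q := proj q (gen F .f₂)

def e₃ (q : F) : Uq F q := e₁ q * e₂ q - q⁻¹ • (e₂ q * e₁ q)
def f₃ (q : F) : Uq F q := f₂ q * f₁ q - q • (f₁ q * f₂ q)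

/-- The ordered monomial `f₁ʷ f₃ˢ f₂ˡ k₁ⁱ k₂ʲ e₁ʳ e₃ʰ e₂ᵗ` attached to the tuple of exponents
`(w, s, l, i, j, r, h, t)`. -/
def monomial (q : F) :
    ℕ × Fin 2 × Fin 2 × ℤ × ℤ × ℕ × Fin 2 × Fin 2 → Uq F q :=
  fun (w, s, l, i, j, r, h, t) =>
    f₁ q ^ w * f₃ q ^ (s : ℕ) * f₂ q ^ (l : ℕ)
      * ((k₁ q ^ i : (Uq F q)ˣ) : Uq F q) * ((k₂ q ^ j : (Uq F q)ˣ) : Uq F q)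
      * e₁ q ^ r * e₃ q ^ (h : ℕ) * e₂ q ^ (t : ℕ)

end Uq

end

end QuantumSl21

namespace QuantumSl21

noncomputable section

/-! The two halves of the claim are independent.

Linear independence comes from a module on which the monomials visibly act independently. Left
multiplication by `f₁, f₂` on the expected basis `f₁ʷ f₃ˢ f₂ˡ` is written down explicitly
(`lowerOne`, `lowerTwo`). Since `e₂e₁ - q e₁e₂ = -q e₃`, the same operators describe `e₁, e₂` on
`e₁ʳ (-q e₃)ʰ e₂ᵗ`; with the torus adjoined they give a regular representation of the nonnegative
part (`borelRegular`). Any representation `B` of that part induces one of `U_q` on `Tri W`. The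
relations involving `f` are checked on basis vectors; those among the `e` and `k` alone, other than
the torus relations, follow from `eq_zero_of_lower`: the top component generates `Tri W` under the
lowering operators, so a defect that passes these up to scalars and kills the top is zero. An
ordered monomial sends `topVec` to a nonzero multiple of its own basis vector (`triRep_monomial`).

Spanning comes from the triangular decomposition: the product of the lower, Cartan and upper spans
contains `1` and is stable under left multiplication by every generator (`triangularSpan_eq_top`).
Within one half the essential point is `triSpan_mul_right_of_serre`: the Serre relation says that
the third root vector skew-commutes with the first, and its square vanishes because `q² ≠ -1`. -/

/-- The free module with coefficients in `W` on the exponents `(w, s, l)` of the ordered monomials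
`f₁ʷ f₃ˢ f₂ˡ`. -/
abbrev Tri (W : Type*) [AddCommGroup W] : Type _ := ℕ × Fin 2 × Fin 2 →₀ W

/-! ### The negative half acting on its ordered monomials. -/

section Nilpotent

variable {F W : Type*} [Field F] [AddCommGroup W] [Module F W]

theorem Tri.hom_ext {V : Type*} [AddCommGroup V] [Module F V] {A B : Tri W →ₗ[F] V}
    (h₀₀ : ∀ w x, A (.single (w, 0, 0) x) = B (.single (w, 0, 0) x))
    (h₀₁ : ∀ w x, A (.single (w, 0, 1) x) = B (.single (w, 0, 1) x))
    (h₁₀ : ∀ w x, A (.single (w, 1, 0) x) = B (.single (w, 1, 0) x))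
    (h₁₁ : ∀ w x, A (.single (w, 1, 1) x) = B (.single (w, 1, 1) x)) : A = B := by
  refine Finsupp.lhom_ext ?_
  rintro ⟨w, s, l⟩ x
  match s, l with
  | 0, 0 => exact h₀₀ w x
  | 0, 1 => exact h₀₁ w x
  | 1, 0 => exact h₁₀ w x
  | 1, 1 => exact h₁₁ w x

/-- The `q`-integer `[w]`. -/
def qInt (q : F) (w : ℕ) : F := (q ^ w - q⁻¹ ^ w) * (q - q⁻¹)⁻¹

@[simp] theorem qInt_zero (q : F) : qInt q 0 = 0 := by simp [qInt]

theorem qInt_one {q : F} (hq : q ≠ 0) (hq' : q ^ 2 - 1 ≠ 0) :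
    qInt q 1 = 1 := by
  have : q - q⁻¹ ≠ 0 := fun h => hq' (by field_simp at h; simpa using h)
  simp [qInt, this]

/-- Left multiplication by `f₁` on ordered monomials. -/
def lowerOne (F W : Type*) [Field F] [AddCommGroup W] [Module F W] : Module.End F (Tri W) :=
  Finsupp.lsum F fun i => Finsupp.lsingle (i.1 + 1, i.2.1, i.2.2)

/-- The coefficients of left multiplication by `f₂` on ordered monomials. -/
def lowerTwoAux (W : Type*) [AddCommGroup W] [Module F W] (q : F) :
    ℕ × Fin 2 × Fin 2 → W →ₗ[F] Tri W
  -- From `f₂f₁ = q f₁f₂ + f₃`, `f₃f₁ = q⁻¹ f₁f₃`, `f₂f₃ = -q f₃f₂` and `f₂² = f₃² = 0`. The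
  -- truncated `w - 1` is harmless at `w = 0`, where `qInt` vanishes.
  | (w, 0, 0) => q ^ w • Finsupp.lsingle (w, 0, 1) + qInt q w • Finsupp.lsingle (w - 1, 1, 0)
  | (w, 0, 1) => qInt q w • Finsupp.lsingle (w - 1, 1, 1)
  | (w, 1, 0) => -(q ^ (w + 1) • Finsupp.lsingle (w, 1, 1))
  | (_, 1, 1) => 0

/-- Left multiplication by `f₂` on ordered monomials. -/
def lowerTwo (W : Type*) [AddCommGroup W] [Module F W] (q : F) : Module.End F (Tri W) :=
  Finsupp.lsum F (lowerTwoAux W q)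

@[simp] theorem lowerOne_single (w : ℕ) (s l : Fin 2) (x : W) :
    lowerOne F W (.single (w, s, l) x) = .single (w + 1, s, l) x := by
  simp [lowerOne]

@[simp] theorem lowerTwo_single₀₀ (q : F) (w : ℕ) (x : W) :
    lowerTwo W q (.single (w, 0, 0) x)
      = q ^ w • .single (w, 0, 1) x + qInt q w • .single (w - 1, 1, 0) x := by
  simp [lowerTwo, lowerTwoAux]

@[simp] theorem lowerTwo_single₀₁ (q : F) (w : ℕ) (x : W) :
    lowerTwo W q (.single (w, 0, 1) x) = qInt q w • .single (w - 1, 1, 1) x := by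
  simp [lowerTwo, lowerTwoAux]

@[simp] theorem lowerTwo_single₁₀ (q : F) (w : ℕ) (x : W) :
    lowerTwo W q (.single (w, 1, 0) x) = -(q ^ (w + 1) • .single (w, 1, 1) x) := by
  simp [lowerTwo, lowerTwoAux]

@[simp] theorem lowerTwo_single₁₁ (q : F) (w : ℕ) (x : W) :
    lowerTwo W q (.single (w, 1, 1) x) = 0 := by
  simp [lowerTwo, lowerTwoAux]

theorem lowerTwo_sq (q : F) : lowerTwo W q ^ 2 = 0 := by
  rw [sq]
  apply Tri.hom_ext <;> intro w x <;> rcases w with _ | w <;>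
    simp [-Finsupp.smul_single]
  module

theorem lower_serre {q : F} (hq : q ≠ 0) (hq' : q ^ 2 - 1 ≠ 0) :
    lowerOne F W ^ 2 * lowerTwo W q
      - (q + q⁻¹) • (lowerOne F W * lowerTwo W q * lowerOne F W)
      + lowerTwo W q * lowerOne F W ^ 2 = 0 := by
  simp only [sq]
  apply Tri.hom_ext <;> intro w x <;> rcases w with _ | w <;>
    simp [-Finsupp.smul_single, qInt] <;>
    match_scalars <;> field_simp <;> ring

/-- The operator `T` on the coefficients, rescaled on each monomial. -/
def diagOp (c : ℕ → ℕ → ℕ → F) (T : Module.End F W) : Module.End F (Tri W) :=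
  Finsupp.lsum F fun i => c i.1 i.2.1 i.2.2 • Finsupp.lsingle i ∘ₗ T

@[simp] theorem diagOp_single (c : ℕ → ℕ → ℕ → F) (T : Module.End F W) (w : ℕ) (s l : Fin 2)
    (x : W) : diagOp c T (.single (w, s, l) x) = c w s l • .single (w, s, l) (T x) := by
  simp [diagOp]

theorem diagOp_mul_eq_one {c d : ℕ → ℕ → ℕ → F} {T S : Module.End F W} (h : T * S = 1)
    (hcd : ∀ w s l, c w s l * d w s l = 1) : diagOp c T * diagOp d S = 1 := by
  refine Finsupp.lhom_ext ?_
  rintro ⟨w, s, l⟩ x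
  have hx : T (S x) = x := LinearMap.congr_fun h x
  simp [-Finsupp.smul_single, smul_smul, hx, mul_comm (d _ _ _), hcd]

/-- The weight by which `k₁` passes `f₁ʷ f₃ˢ f₂ˡ`. -/
def wtOne (q : F) (w s l : ℕ) : F := q⁻¹ ^ (2 * w) * q⁻¹ ^ s * q ^ l

/-- The weight by which `k₂` passes `f₁ʷ f₃ˢ f₂ˡ`. -/
def wtTwo (q : F) (w s _l : ℕ) : F := q ^ w * q ^ s

theorem wtOne_mul_inv {q : F} (hq : q ≠ 0) (w s l : ℕ) : wtOne q w s l * wtOne q⁻¹ w s l = 1 := by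
  simp only [wtOne, inv_inv, inv_pow]; field_simp

theorem wtTwo_mul_inv {q : F} (hq : q ≠ 0) (w s l : ℕ) : wtTwo q w s l * wtTwo q⁻¹ w s l = 1 := by
  simp only [wtTwo, inv_pow]; field_simp

end Nilpotent

/-! ### Representations of the nonnegative part. -/

/-- A representation of the nonnegative part of `U_q`. -/
structure BorelRep {F : Type*} [Field F] (q : F) (W : Type*) [AddCommGroup W] [Module F W] where
  (k₁ k₁i k₂ k₂i e₁ e₂ : Module.End F W)
  k₁_mul_inv : k₁ * k₁i = 1
  k₁_inv_mul : k₁i * k₁ = 1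
  k₂_mul_inv : k₂ * k₂i = 1
  k₂_inv_mul : k₂i * k₂ = 1
  k₂_k₁ : k₂ * k₁ = k₁ * k₂
  e₁_k₁ : e₁ * k₁ = q⁻¹ ^ 2 • (k₁ * e₁)
  e₂_k₁ : e₂ * k₁ = q • (k₁ * e₂)
  e₁_k₂ : e₁ * k₂ = q • (k₂ * e₁)
  e₂_k₂ : e₂ * k₂ = k₂ * e₂
  e₂_sq : e₂ ^ 2 = 0
  e_serre : e₁ ^ 2 * e₂ - (q + q⁻¹) • (e₁ * e₂ * e₁) + e₂ * e₁ ^ 2 = 0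

/-- The coefficient space of the torus `k₁ⁱ k₂ʲ`. -/
abbrev Torus (F : Type*) [Field F] : Type _ := ℤ × ℤ →₀ F

/-- Translation of the exponents. -/
def torusShift (F : Type*) [Field F] (z : ℤ × ℤ) : Module.End F (Torus F) :=
  Finsupp.lmapDomain F F (· + z)

@[simp] theorem torusShift_single {F : Type*} [Field F] (z y : ℤ × ℤ) (a : F) :
    torusShift F z (.single y a) = .single (y + z) a := by
  simp [torusShift]

theorem torusShift_mul {F : Type*} [Field F] (z y : ℤ × ℤ) :
    torusShift F z * torusShift F y = torusShift F (z + y) := by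
  refine Finsupp.lhom_ext fun x a => ?_
  simp [add_comm, add_left_comm]

theorem torusShift_zero {F : Type*} [Field F] : torusShift F 0 = 1 := by
  refine Finsupp.lhom_ext fun x a => ?_
  simp

theorem torusShift_mul_eq_one {F : Type*} [Field F] {z y : ℤ × ℤ} (h : z + y = 0) :
    torusShift F z * torusShift F y = 1 := by
  rw [torusShift_mul, h, torusShift_zero]

@[simp] theorem torusShift_torusShift {F : Type*} [Field F] (z y : ℤ × ℤ) (x : Torus F) :
    torusShift F z (torusShift F y x) = torusShift F (z + y) x := by
  rw [← torusShift_mul]; rfl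

/-- The regular representation of the nonnegative part, on the monomials
`e₁ʳ (-q e₃)ʰ e₂ᵗ k₁ⁱ k₂ʲ`. -/
def borelRegular {F : Type*} [Field F] {q : F} (hq : q ≠ 0) (hq' : q ^ 2 - 1 ≠ 0) :
    BorelRep q (Tri (Torus F)) where
  -- The weights of `e₁, e₃, e₂` are inverse to those of `f₁, f₃, f₂`, hence the parameter `q⁻¹`.
  k₁ := diagOp (wtOne q⁻¹) (torusShift F (1, 0))
  k₁i := diagOp (wtOne q) (torusShift F (-1, 0))
  k₂ := diagOp (wtTwo q⁻¹) (torusShift F (0, 1))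
  k₂i := diagOp (wtTwo q) (torusShift F (0, -1))
  e₁ := lowerOne F _
  e₂ := lowerTwo _ q
  k₁_mul_inv := diagOp_mul_eq_one (torusShift_mul_eq_one (by simp)) fun w s l => by
    rw [mul_comm, wtOne_mul_inv hq]
  k₁_inv_mul := diagOp_mul_eq_one (torusShift_mul_eq_one (by simp))
    (wtOne_mul_inv hq)
  k₂_mul_inv := diagOp_mul_eq_one (torusShift_mul_eq_one (by simp)) fun w s l => by
    rw [mul_comm, wtTwo_mul_inv hq]
  k₂_inv_mul := diagOp_mul_eq_one (torusShift_mul_eq_one (by simp))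
    (wtTwo_mul_inv hq)
  k₂_k₁ := by
    apply Tri.hom_ext <;> intro w x <;>
      simp [-Finsupp.smul_single, wtOne, wtTwo] <;> module
  e₁_k₁ := by
    apply Tri.hom_ext <;> intro w x <;>
      simp [-Finsupp.smul_single, wtOne, smul_smul] <;> congr 1 <;> field_simp <;> ring
  e₂_k₁ := by
    apply Tri.hom_ext <;> intro w x <;> rcases w with _ | w <;>
      simp [-Finsupp.smul_single, wtOne] <;> match_scalars <;> field_simp <;> ring
  e₁_k₂ := by
    apply Tri.hom_ext <;> intro w x <;>
      simp [-Finsupp.smul_single, wtTwo, smul_smul] <;> congr 1 <;> field_simp <;> ring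
  e₂_k₂ := by
    apply Tri.hom_ext <;> intro w x <;> rcases w with _ | w <;>
      simp [-Finsupp.smul_single, wtTwo] <;> match_scalars <;> field_simp <;> ring
  e₂_sq := lowerTwo_sq q
  e_serre := lower_serre hq hq'

/-! ### The induced module and the relations that involve `f₁, f₂`. -/

namespace BorelRep

variable {F W : Type*} [Field F] [AddCommGroup W] [Module F W] {q : F} (B : BorelRep q W)

/-- The coefficient operator of `f₁ʷ⁻¹ f₃ˢ f₂ˡ` in `e₁ f₁ʷ f₃ˢ f₂ˡ`. -/
def raiseOneCoeff (w s l : ℕ) : Module.End F W :=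
  -- Moving `e₁` past `w` factors `f₁` produces the geometric sums of `q⁻²` and `q²`; the last
  -- factors come from moving `k₁^{±1}` past `f₃ˢ f₂ˡ`. Everything vanishes at `w = 0`.
  ((q - q⁻¹)⁻¹ * ((q⁻¹ ^ (2 * w) - 1) * (q⁻¹ ^ 2 - 1)⁻¹ * (q⁻¹ ^ s * q ^ l))) • B.k₁
    - ((q - q⁻¹)⁻¹ * ((q ^ (2 * w) - 1) * (q ^ 2 - 1)⁻¹ * (q ^ s * q⁻¹ ^ l))) • B.k₁i

/-- The values of the operator of `e₁` on ordered monomials. -/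
def raiseOneAux : ℕ × Fin 2 × Fin 2 → W →ₗ[F] Tri W
  | (w, 0, 0) => Finsupp.lsingle (w, 0, 0) ∘ₗ B.e₁
      + Finsupp.lsingle (w - 1, 0, 0) ∘ₗ B.raiseOneCoeff w 0 0
  | (w, 0, 1) => Finsupp.lsingle (w, 0, 1) ∘ₗ B.e₁
      + Finsupp.lsingle (w - 1, 0, 1) ∘ₗ B.raiseOneCoeff w 0 1
  -- Here `e₁f₃ = f₃e₁ - q f₂k₁`; the extra term disappears in the case `(w, 1, 1)` because `f₂² =
  -- 0`.
  | (w, 1, 0) => Finsupp.lsingle (w, 1, 0) ∘ₗ B.e₁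
      + Finsupp.lsingle (w - 1, 1, 0) ∘ₗ B.raiseOneCoeff w 1 0
      - q • Finsupp.lsingle (w, 0, 1) ∘ₗ B.k₁
  | (w, 1, 1) => Finsupp.lsingle (w, 1, 1) ∘ₗ B.e₁
      + Finsupp.lsingle (w - 1, 1, 1) ∘ₗ B.raiseOneCoeff w 1 1

/-- The operator of `e₁` on the representation induced from `B`. -/
def raiseOne : Module.End F (Tri W) := Finsupp.lsum F B.raiseOneAux

/-- The values of the operator of `e₂` on ordered monomials. -/
def raiseTwoAux : ℕ × Fin 2 × Fin 2 → W →ₗ[F] Tri W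
  | (w, 0, 0) => Finsupp.lsingle (w, 0, 0) ∘ₗ B.e₂
  | (w, 0, 1) => -Finsupp.lsingle (w, 0, 1) ∘ₗ B.e₂
      + Finsupp.lsingle (w, 0, 0) ∘ₗ ((q - q⁻¹)⁻¹ • (B.k₂ - B.k₂i))
  -- Here `e₂f₃ = -f₃e₂ + f₁k₂⁻¹`: the `k₂` terms cancel.
  | (w, 1, 0) => -Finsupp.lsingle (w, 1, 0) ∘ₗ B.e₂
      + Finsupp.lsingle (w + 1, 0, 0) ∘ₗ B.k₂i
  | (w, 1, 1) => Finsupp.lsingle (w, 1, 1) ∘ₗ B.e₂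
      - Finsupp.lsingle (w, 1, 0) ∘ₗ ((q - q⁻¹)⁻¹ • (B.k₂ - B.k₂i))
      + Finsupp.lsingle (w + 1, 0, 1) ∘ₗ B.k₂i

/-- The operator of `e₂` on the representation induced from `B`. -/
def raiseTwo : Module.End F (Tri W) := Finsupp.lsum F B.raiseTwoAux

@[simp] theorem raiseOne_single₀₀ (w : ℕ) (x : W) :
    B.raiseOne (.single (w, 0, 0) x)
      = .single (w, 0, 0) (B.e₁ x) + .single (w - 1, 0, 0) (B.raiseOneCoeff w 0 0 x) := by
  simp [raiseOne, raiseOneAux]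

@[simp] theorem raiseOne_single₀₁ (w : ℕ) (x : W) :
    B.raiseOne (.single (w, 0, 1) x)
      = .single (w, 0, 1) (B.e₁ x) + .single (w - 1, 0, 1) (B.raiseOneCoeff w 0 1 x) := by
  simp [raiseOne, raiseOneAux]

@[simp] theorem raiseOne_single₁₀ (w : ℕ) (x : W) :
    B.raiseOne (.single (w, 1, 0) x)
      = .single (w, 1, 0) (B.e₁ x) + .single (w - 1, 1, 0) (B.raiseOneCoeff w 1 0 x)
        - q • .single (w, 0, 1) (B.k₁ x) := by
  simp [raiseOne, raiseOneAux]

@[simp] theorem raiseOne_single₁₁ (w : ℕ) (x : W) :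
    B.raiseOne (.single (w, 1, 1) x)
      = .single (w, 1, 1) (B.e₁ x) + .single (w - 1, 1, 1) (B.raiseOneCoeff w 1 1 x) := by
  simp [raiseOne, raiseOneAux]

@[simp] theorem raiseTwo_single₀₀ (w : ℕ) (x : W) :
    B.raiseTwo (.single (w, 0, 0) x) = .single (w, 0, 0) (B.e₂ x) := by
  simp [raiseTwo, raiseTwoAux]

@[simp] theorem raiseTwo_single₀₁ (w : ℕ) (x : W) :
    B.raiseTwo (.single (w, 0, 1) x) = -.single (w, 0, 1) (B.e₂ x)
      + (q - q⁻¹)⁻¹ • (.single (w, 0, 0) (B.k₂ x) - .single (w, 0, 0) (B.k₂i x)) := by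
  simp [raiseTwo, raiseTwoAux, smul_sub]

@[simp] theorem raiseTwo_single₁₀ (w : ℕ) (x : W) :
    B.raiseTwo (.single (w, 1, 0) x)
      = -.single (w, 1, 0) (B.e₂ x) + .single (w + 1, 0, 0) (B.k₂i x) := by
  simp [raiseTwo, raiseTwoAux]

@[simp] theorem raiseTwo_single₁₁ (w : ℕ) (x : W) :
    B.raiseTwo (.single (w, 1, 1) x) = .single (w, 1, 1) (B.e₂ x)
      - (q - q⁻¹)⁻¹ • (.single (w, 1, 0) (B.k₂ x) - .single (w, 1, 0) (B.k₂i x))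
      + .single (w + 1, 0, 1) (B.k₂i x) := by
  simp [raiseTwo, raiseTwoAux, smul_sub]

/-- The operator of `k₁` on the representation induced from `B`. -/
def torusOne : Module.End F (Tri W) := diagOp (wtOne q) B.k₁
/-- The operator of `k₁⁻¹` on the representation induced from `B`. -/
def torusOneInv : Module.End F (Tri W) := diagOp (wtOne q⁻¹) B.k₁i
/-- The operator of `k₂` on the representation induced from `B`. -/
def torusTwo : Module.End F (Tri W) := diagOp (wtTwo q) B.k₂
/-- The operator of `k₂⁻¹` on the representation induced from `B`. -/
def torusTwoInv : Module.End F (Tri W) := diagOp (wtTwo q⁻¹) B.k₂i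

theorem torusOne_mul_inv (hq : q ≠ 0) : B.torusOne * B.torusOneInv = 1 :=
  diagOp_mul_eq_one B.k₁_mul_inv (wtOne_mul_inv hq)

theorem torusOne_inv_mul (hq : q ≠ 0) : B.torusOneInv * B.torusOne = 1 :=
  diagOp_mul_eq_one B.k₁_inv_mul fun w s l => by rw [mul_comm, wtOne_mul_inv hq]

theorem torusTwo_mul_inv (hq : q ≠ 0) : B.torusTwo * B.torusTwoInv = 1 :=
  diagOp_mul_eq_one B.k₂_mul_inv (wtTwo_mul_inv hq)

theorem torusTwo_inv_mul (hq : q ≠ 0) : B.torusTwoInv * B.torusTwo = 1 :=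
  diagOp_mul_eq_one B.k₂_inv_mul fun w s l => by rw [mul_comm, wtTwo_mul_inv hq]

theorem torusTwo_mul_torusOne : B.torusTwo * B.torusOne = B.torusOne * B.torusTwo := by
  have h (x : W) : B.k₂ (B.k₁ x) = B.k₁ (B.k₂ x) := LinearMap.congr_fun B.k₂_k₁ x
  apply Tri.hom_ext <;> intro w x <;>
    simp [-Finsupp.smul_single, torusOne, torusTwo, wtOne, wtTwo, h] <;> module

theorem torusOne_mul_lowerOne (hq : q ≠ 0) :
    B.torusOne * lowerOne F W = q⁻¹ ^ 2 • (lowerOne F W * B.torusOne) := by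
  apply Tri.hom_ext <;> intro w x <;>
    simp [-Finsupp.smul_single, torusOne, wtOne, smul_smul] <;> congr 1 <;> field_simp <;> ring

theorem torusTwo_mul_lowerOne :
    B.torusTwo * lowerOne F W = q • (lowerOne F W * B.torusTwo) := by
  apply Tri.hom_ext <;> intro w x <;>
    simp [-Finsupp.smul_single, torusTwo, wtTwo, smul_smul] <;> congr 1 <;> ring

theorem torusOne_mul_lowerTwo (hq : q ≠ 0) :
    B.torusOne * lowerTwo W q = q • (lowerTwo W q * B.torusOne) := by
  apply Tri.hom_ext <;> intro w x <;> rcases w with _ | w <;>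
    simp [-Finsupp.smul_single, torusOne, wtOne] <;> match_scalars <;> field_simp <;> ring

theorem torusTwo_mul_lowerTwo (hq : q ≠ 0) :
    B.torusTwo * lowerTwo W q = lowerTwo W q * B.torusTwo := by
  apply Tri.hom_ext <;> intro w x <;> rcases w with _ | w <;>
    simp [-Finsupp.smul_single, torusTwo, wtTwo] <;> match_scalars <;> field_simp <;> ring

theorem raiseOne_mul_lowerOne (hq : q ≠ 0) (hq' : q ^ 2 - 1 ≠ 0) :
    B.raiseOne * lowerOne F W = lowerOne F W * B.raiseOne
      + (q - q⁻¹)⁻¹ • (B.torusOne - B.torusOneInv) := by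
  have h : 1 - q ^ 2 ≠ 0 := fun h => hq' (by linear_combination -h)
  apply Tri.hom_ext <;> intro w x <;> rcases w with _ | w <;>
    simp [-Finsupp.smul_single, torusOne, torusOneInv, wtOne, raiseOneCoeff, Finsupp.single_sub,
      ← Finsupp.smul_single] <;>
    match_scalars <;> field_simp <;> ring

theorem raiseOne_mul_lowerTwo (hq : q ≠ 0) (hq' : q ^ 2 - 1 ≠ 0) :
    B.raiseOne * lowerTwo W q = lowerTwo W q * B.raiseOne := by
  have h : 1 - q ^ 2 ≠ 0 := fun h => hq' (by linear_combination -h)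
  apply Tri.hom_ext <;> intro w x <;> rcases w with _ | w <;>
    simp [-Finsupp.smul_single, raiseOneCoeff, Finsupp.single_sub, qInt,
      ← Finsupp.smul_single] <;>
    match_scalars <;> field_simp <;> ring

theorem raiseTwo_mul_lowerOne :
    B.raiseTwo * lowerOne F W = lowerOne F W * B.raiseTwo := by
  apply Tri.hom_ext <;> intro w x <;>
    simp [-Finsupp.smul_single]

theorem raiseTwo_mul_lowerTwo (hq : q ≠ 0) (hq' : q ^ 2 - 1 ≠ 0) :
    B.raiseTwo * lowerTwo W q = -(lowerTwo W q * B.raiseTwo)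
      + (q - q⁻¹)⁻¹ • (B.torusTwo - B.torusTwoInv) := by
  apply Tri.hom_ext <;> intro w x <;> rcases w with _ | w <;>
    simp [-Finsupp.smul_single, torusTwo, torusTwoInv, wtTwo, qInt] <;>
    match_scalars <;> field_simp <;> ring

/-- Operators that commute with the lowering operators up to scalars and vanish on the top
component are zero. -/
theorem eq_zero_of_lower (hq : q ≠ 0) (hq' : q ^ 2 - 1 ≠ 0) {S : Module.End F (Tri W)} {a b : F}
    (h₁ : S * lowerOne F W = a • (lowerOne F W * S))
    (h₂ : S * lowerTwo W q = b • (lowerTwo W q * S))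
    (h₀ : ∀ x, S (.single (0, 0, 0) x) = 0) : S = 0 := by
  have h₁' (v) : S (lowerOne F W v) = a • lowerOne F W (S v) := LinearMap.congr_fun h₁ v
  have h₂' (v) : S (lowerTwo W q v) = b • lowerTwo W q (S v) := LinearMap.congr_fun h₂ v
  have lift (s l : Fin 2) (h : ∀ x, S (.single (0, s, l) x) = 0) (w : ℕ) (x : W) :
      S (.single (w, s, l) x) = 0 := by
    induction w with
    | zero => exact h x
    | succ w ih => rw [← lowerOne_single (F := F), h₁', ih, map_zero, smul_zero]
  have k₀₁ (x : W) : S (.single (0, 0, 1) x) = 0 := by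
    have := h₂' (.single (0, 0, 0) x)
    simpa [h₀] using this
  have k (l : Fin 2) (h : ∀ w x, S (.single (w, 0, l) x) = 0) (x : W) :
      S (.single (0, 1, l) x) = 0 := by
    -- This is `f₃ = f₂f₁ - q f₁f₂` applied to a vector with `s = 0`, where `S` is already known to
    -- vanish.
    have e : (.single (0, 1, l) x : Tri W) = lowerTwo W q (.single (1, 0, l) x)
        - q • lowerOne F W (lowerTwo W q (.single (0, 0, l) x)) := by
      have h1 : qInt q 1 = 1 := qInt_one hq hq'
      match l with
      | 0 => simp [-Finsupp.smul_single, h1]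
      | 1 => simp [-Finsupp.smul_single, h1]
    rw [e, map_sub, map_smul, h₂', h₁', h₂', h, h]
    simp
  apply Tri.hom_ext
  · exact lift 0 0 h₀
  · exact lift 0 1 k₀₁
  · exact lift 1 0 (k 0 (lift 0 0 h₀))
  · exact lift 1 1 (k 1 (lift 0 1 k₀₁))

end BorelRep

/-! ### Relations of the raising operators with the torus and among themselves. -/

theorem mul_inv_of_skew_comm {F A : Type*} [Field F] [Ring A] [Algebra F A] {K Ki X : A} {a : F}
    (h₁ : K * Ki = 1) (h₂ : Ki * K = 1) (ha : a ≠ 0) (h : X * K = a • (K * X)) :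
    X * Ki = a⁻¹ • (Ki * X) := by
  have : Ki * (X * K) * Ki = a • (Ki * (K * X) * Ki) := by rw [h]; simp
  rw [mul_assoc, mul_assoc X, h₁, mul_one, ← mul_assoc Ki, h₂, one_mul] at this
  rw [this, smul_smul, inv_mul_cancel₀ ha, one_smul]

theorem inv_mul_of_skew_comm {F A : Type*} [Field F] [Ring A] [Algebra F A] {K Ki X : A} {a : F}
    (h₁ : K * Ki = 1) (h₂ : Ki * K = 1) (ha : a ≠ 0) (h : K * X = a • (X * K)) :
    Ki * X = a⁻¹ • (X * Ki) := by
  have h' : X * K = a⁻¹ • (K * X) := by rw [h, smul_smul, inv_mul_cancel₀ ha, one_smul]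
  rw [mul_inv_of_skew_comm h₁ h₂ (inv_ne_zero ha) h', smul_smul, inv_inv, inv_mul_cancel₀ ha,
    one_smul]

namespace BorelRep

variable {F W : Type*} [Field F] [AddCommGroup W] [Module F W] {q : F} (B : BorelRep q W)

theorem raiseOneCoeff_zero : B.raiseOneCoeff 0 0 0 = 0 := by simp [raiseOneCoeff]

theorem raiseOne_top (x : W) :
    B.raiseOne (.single (0, 0, 0) x) = .single (0, 0, 0) (B.e₁ x) := by
  simp [raiseOneCoeff_zero]

theorem torusOne_top (x : W) :
    B.torusOne (.single (0, 0, 0) x) = .single (0, 0, 0) (B.k₁ x) := by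
  simp [torusOne, wtOne]

theorem torusTwo_top (x : W) :
    B.torusTwo (.single (0, 0, 0) x) = .single (0, 0, 0) (B.k₂ x) := by
  simp [torusTwo, wtTwo]

theorem torusTwo_mul_torusOneInv (hq : q ≠ 0) :
    B.torusTwo * B.torusOneInv = B.torusOneInv * B.torusTwo := by
  simpa using mul_inv_of_skew_comm (B.torusOne_mul_inv hq) (B.torusOne_inv_mul hq) one_ne_zero
    (B.torusTwo_mul_torusOne.trans (one_smul F _).symm)

theorem torusTwoInv_mul_torusOne (hq : q ≠ 0) :
    B.torusTwoInv * B.torusOne = B.torusOne * B.torusTwoInv := by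
  simpa using inv_mul_of_skew_comm (B.torusTwo_mul_inv hq) (B.torusTwo_inv_mul hq) one_ne_zero
    (B.torusTwo_mul_torusOne.trans (one_smul F _).symm)

/-- The defect `X K - a K X` passes each lowering operator with scalar `sᵢ bᵢ`, since `hH₁` and
`hH₂` cancel the corrections; `eq_zero_of_lower` leaves only the top component to check. -/
theorem skew_comm_of_lower (hq : q ≠ 0) (hq' : q ^ 2 - 1 ≠ 0) {X K H₁ H₂ : Module.End F (Tri W)}
    {a s₁ s₂ b₁ b₂ : F}
    (hX₁ : X * lowerOne F W = s₁ • (lowerOne F W * X) + H₁)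
    (hX₂ : X * lowerTwo W q = s₂ • (lowerTwo W q * X) + H₂)
    (hK₁ : K * lowerOne F W = b₁ • (lowerOne F W * K))
    (hK₂ : K * lowerTwo W q = b₂ • (lowerTwo W q * K))
    (hH₁ : b₁ • (H₁ * K) = a • (K * H₁)) (hH₂ : b₂ • (H₂ * K) = a • (K * H₂))
    (h₀ : ∀ x, X (K (.single (0, 0, 0) x)) = a • K (X (.single (0, 0, 0) x))) :
    X * K = a • (K * X) := by
  have aux {f H : Module.End F (Tri W)} {s b : F} (hX : X * f = s • (f * X) + H)
      (hK : K * f = b • (f * K)) (hH : b • (H * K) = a • (K * H)) :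
      (X * K - a • (K * X)) * f = (s * b) • (f * (X * K - a • (K * X))) := by
    have h₁ : X * K * f = (s * b) • (f * X * K) + b • (H * K) := by
      rw [mul_assoc, hK, mul_smul_comm, ← mul_assoc, hX, add_mul, smul_add, smul_mul_assoc,
        smul_smul, mul_comm s]
    have h₂ : K * X * f = (s * b) • (f * K * X) + K * H := by
      rw [mul_assoc, hX, mul_add, mul_smul_comm, ← mul_assoc, hK, smul_mul_assoc, smul_smul]
    rw [sub_mul, smul_mul_assoc, h₁, h₂, hH, mul_sub, mul_smul_comm, ← mul_assoc, ← mul_assoc]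
    module
  rw [← sub_eq_zero]
  refine eq_zero_of_lower hq hq' (aux hX₁ hK₁ hH₁) (aux hX₂ hK₂ hH₂) fun x => ?_
  simp [-Finsupp.smul_single, h₀]

theorem raiseOne_mul_torusOne (hq : q ≠ 0) (hq' : q ^ 2 - 1 ≠ 0) :
    B.raiseOne * B.torusOne = q⁻¹ ^ 2 • (B.torusOne * B.raiseOne) := by
  have hB (x) : B.e₁ (B.k₁ x) = q⁻¹ ^ 2 • B.k₁ (B.e₁ x) := LinearMap.congr_fun B.e₁_k₁ x
  refine skew_comm_of_lower hq hq' (s₁ := 1) (s₂ := 1) (H₂ := 0)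
    ((B.raiseOne_mul_lowerOne hq hq').trans (by rw [one_smul]))
    ((B.raiseOne_mul_lowerTwo hq hq').trans (by rw [one_smul, add_zero]))
    (B.torusOne_mul_lowerOne hq) (B.torusOne_mul_lowerTwo hq) ?_ (by simp) fun x => ?_
  · rw [smul_mul_assoc, mul_smul_comm, sub_mul, mul_sub, B.torusOne_mul_inv hq,
      B.torusOne_inv_mul hq]
  · simp only [raiseOne_top, torusOne_top, hB, ← Finsupp.smul_single]

theorem raiseOne_mul_torusTwo (hq : q ≠ 0) (hq' : q ^ 2 - 1 ≠ 0) :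
    B.raiseOne * B.torusTwo = q • (B.torusTwo * B.raiseOne) := by
  have hB (x) : B.e₁ (B.k₂ x) = q • B.k₂ (B.e₁ x) := LinearMap.congr_fun B.e₁_k₂ x
  refine skew_comm_of_lower hq hq' (s₁ := 1) (s₂ := 1) (b₂ := 1) (H₂ := 0)
    ((B.raiseOne_mul_lowerOne hq hq').trans (by rw [one_smul]))
    ((B.raiseOne_mul_lowerTwo hq hq').trans (by rw [one_smul, add_zero]))
    B.torusTwo_mul_lowerOne ((B.torusTwo_mul_lowerTwo hq).trans (by rw [one_smul])) ?_ (by simp)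
    fun x => ?_
  · rw [smul_mul_assoc, mul_smul_comm, sub_mul, mul_sub, B.torusTwo_mul_torusOne,
      B.torusTwo_mul_torusOneInv hq]
  · simp only [raiseOne_top, torusTwo_top, hB, ← Finsupp.smul_single]

theorem raiseTwo_mul_lowerTwo' (hq : q ≠ 0) (hq' : q ^ 2 - 1 ≠ 0) :
    B.raiseTwo * lowerTwo W q = (-1 : F) • (lowerTwo W q * B.raiseTwo)
      + (q - q⁻¹)⁻¹ • (B.torusTwo - B.torusTwoInv) := by
  rw [B.raiseTwo_mul_lowerTwo hq hq']
  refine LinearMap.ext fun v => ?_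
  simp

theorem raiseTwo_mul_torusOne (hq : q ≠ 0) (hq' : q ^ 2 - 1 ≠ 0) :
    B.raiseTwo * B.torusOne = q • (B.torusOne * B.raiseTwo) := by
  have hB (x) : B.e₂ (B.k₁ x) = q • B.k₁ (B.e₂ x) := LinearMap.congr_fun B.e₂_k₁ x
  refine skew_comm_of_lower hq hq' (s₁ := 1) (s₂ := -1) (H₁ := 0)
    (B.raiseTwo_mul_lowerOne.trans (by rw [one_smul, add_zero]))
    (B.raiseTwo_mul_lowerTwo' hq hq')
    (B.torusOne_mul_lowerOne hq) (B.torusOne_mul_lowerTwo hq) (by simp) ?_ fun x => ?_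
  · rw [smul_mul_assoc, mul_smul_comm, sub_mul, mul_sub, B.torusTwo_mul_torusOne,
      B.torusTwoInv_mul_torusOne hq]
  · simp only [raiseTwo_single₀₀, torusOne_top, hB, ← Finsupp.smul_single]

theorem raiseTwo_mul_torusTwo (hq : q ≠ 0) (hq' : q ^ 2 - 1 ≠ 0) :
    B.raiseTwo * B.torusTwo = B.torusTwo * B.raiseTwo := by
  have hB (x) : B.e₂ (B.k₂ x) = B.k₂ (B.e₂ x) := LinearMap.congr_fun B.e₂_k₂ x
  rw [← one_smul F (B.torusTwo * B.raiseTwo)]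
  refine skew_comm_of_lower hq hq' (s₁ := 1) (s₂ := -1) (b₂ := 1) (H₁ := 0)
    (B.raiseTwo_mul_lowerOne.trans (by rw [one_smul, add_zero]))
    (B.raiseTwo_mul_lowerTwo' hq hq')
    B.torusTwo_mul_lowerOne ((B.torusTwo_mul_lowerTwo hq).trans (by rw [one_smul])) (by simp) ?_
    fun x => ?_
  · rw [smul_mul_assoc, mul_smul_comm, sub_mul, mul_sub, B.torusTwo_mul_inv hq,
      B.torusTwo_inv_mul hq]
  · simp only [raiseTwo_single₀₀, torusTwo_top, hB, one_smul]

/-- In `e₂²f₂` the two sign changes cancel, and so do the two corrections, because `e₂` commutes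
with `k₂^{±1}`. Thus `e₂²` commutes with `f₁` and `f₂`. -/
theorem raiseTwo_sq (hq : q ≠ 0) (hq' : q ^ 2 - 1 ≠ 0) : B.raiseTwo ^ 2 = 0 := by
  have hK := B.raiseTwo_mul_torusTwo hq hq'
  have hKi : B.raiseTwo * B.torusTwoInv = B.torusTwoInv * B.raiseTwo := by
    simpa using mul_inv_of_skew_comm (B.torusTwo_mul_inv hq) (B.torusTwo_inv_mul hq) one_ne_zero
      (hK.trans (one_smul F _).symm)
  refine eq_zero_of_lower hq hq' (a := 1) (b := 1) ?_ ?_ fun x => ?_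
  · rw [one_smul, sq, mul_assoc, B.raiseTwo_mul_lowerOne, ← mul_assoc, B.raiseTwo_mul_lowerOne,
      mul_assoc]
  · rw [one_smul, sq, mul_assoc, B.raiseTwo_mul_lowerTwo' hq hq', mul_add, mul_smul_comm, ← mul_assoc,
      B.raiseTwo_mul_lowerTwo' hq hq', add_mul, smul_mul_assoc, mul_smul_comm, smul_mul_assoc,
      mul_sub, sub_mul, hK, hKi, mul_assoc]
    module
  · have h : B.e₂ (B.e₂ x) = 0 := by simpa [sq] using LinearMap.congr_fun B.e₂_sq x
    rw [sq, Module.End.mul_apply, raiseTwo_single₀₀, raiseTwo_single₀₀, h, Finsupp.single_zero]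

theorem raise_serre (hq : q ≠ 0) (hq' : q ^ 2 - 1 ≠ 0) :
    B.raiseOne ^ 2 * B.raiseTwo - (q + q⁻¹) • (B.raiseOne * B.raiseTwo * B.raiseOne)
      + B.raiseTwo * B.raiseOne ^ 2 = 0 := by
  have hEF₁₁ (v) : B.raiseOne (lowerOne F W v) = lowerOne F W (B.raiseOne v)
      + (q - q⁻¹)⁻¹ • (B.torusOne v - B.torusOneInv v) :=
    LinearMap.congr_fun (B.raiseOne_mul_lowerOne hq hq') v
  have hEF₁₂ (v) : B.raiseOne (lowerTwo W q v) = lowerTwo W q (B.raiseOne v) :=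
    LinearMap.congr_fun (B.raiseOne_mul_lowerTwo hq hq') v
  have hEF₂₁ (v) : B.raiseTwo (lowerOne F W v) = lowerOne F W (B.raiseTwo v) :=
    LinearMap.congr_fun B.raiseTwo_mul_lowerOne v
  have hEF₂₂ (v) : B.raiseTwo (lowerTwo W q v) = -lowerTwo W q (B.raiseTwo v)
      + (q - q⁻¹)⁻¹ • (B.torusTwo v - B.torusTwoInv v) :=
    LinearMap.congr_fun (B.raiseTwo_mul_lowerTwo hq hq') v
  have hEK₁₁ (v) : B.raiseOne (B.torusOne v) = q⁻¹ ^ 2 • B.torusOne (B.raiseOne v) :=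
    LinearMap.congr_fun (B.raiseOne_mul_torusOne hq hq') v
  have hEK₁₁' (v) : B.raiseOne (B.torusOneInv v) = (q⁻¹ ^ 2)⁻¹ • B.torusOneInv (B.raiseOne v) :=
    LinearMap.congr_fun (mul_inv_of_skew_comm (B.torusOne_mul_inv hq) (B.torusOne_inv_mul hq)
      (by positivity) (B.raiseOne_mul_torusOne hq hq')) v
  have hEK₁₂ (v) : B.raiseOne (B.torusTwo v) = q • B.torusTwo (B.raiseOne v) :=
    LinearMap.congr_fun (B.raiseOne_mul_torusTwo hq hq') v
  have hEK₁₂' (v) : B.raiseOne (B.torusTwoInv v) = q⁻¹ • B.torusTwoInv (B.raiseOne v) :=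
    LinearMap.congr_fun (mul_inv_of_skew_comm (B.torusTwo_mul_inv hq) (B.torusTwo_inv_mul hq)
      hq (B.raiseOne_mul_torusTwo hq hq')) v
  have hEK₂₁ (v) : B.raiseTwo (B.torusOne v) = q • B.torusOne (B.raiseTwo v) :=
    LinearMap.congr_fun (B.raiseTwo_mul_torusOne hq hq') v
  have hEK₂₁' (v) : B.raiseTwo (B.torusOneInv v) = q⁻¹ • B.torusOneInv (B.raiseTwo v) :=
    LinearMap.congr_fun (mul_inv_of_skew_comm (B.torusOne_mul_inv hq) (B.torusOne_inv_mul hq)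
      hq (B.raiseTwo_mul_torusOne hq hq')) v
  -- The Serre element commutes with `f₁` and, being of degree one in `e₂`, anticommutes with `f₂`.
  -- For `f₂` the corrections cancel by `q^{±2} - (q + q⁻¹) q^{±1} + 1 = 0`.
  refine eq_zero_of_lower hq hq' (a := 1) (b := -1) ?_ ?_ fun x => ?_
  · refine LinearMap.ext fun v => ?_
    simp only [sq, Module.End.mul_apply, LinearMap.add_apply, LinearMap.sub_apply,
      LinearMap.smul_apply, map_add, map_sub, map_smul, hEF₁₁, hEF₂₁, hEK₁₁, hEK₁₁', hEK₂₁,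
      hEK₂₁']
    match_scalars <;> field_simp <;> ring
  · refine LinearMap.ext fun v => ?_
    simp only [sq, Module.End.mul_apply, LinearMap.add_apply, LinearMap.sub_apply,
      LinearMap.smul_apply, map_add, map_sub, map_smul, map_neg, hEF₁₂, hEF₂₂, hEK₁₂, hEK₁₂']
    match_scalars <;> field_simp <;> ring
  · have h := LinearMap.congr_fun B.e_serre x
    simp only [sq, Module.End.mul_apply, LinearMap.add_apply, LinearMap.sub_apply,
      LinearMap.smul_apply, LinearMap.zero_apply] at h ⊢
    simp only [raiseOne_top, raiseTwo_single₀₀, Finsupp.smul_single, ← Finsupp.single_add,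
      ← Finsupp.single_sub, h, Finsupp.single_zero]

end BorelRep

/-! ### The action of `U_q` on the induced module. -/

namespace BorelRep

variable {F W : Type*} [Field F] [AddCommGroup W] [Module F W] {q : F} (B : BorelRep q W)

/-- The operators of the generators on the representation induced from `B`. -/
def genOp : Gen → Module.End F (Tri W)
  | .k₁ => B.torusOne
  | .k₁inv => B.torusOneInv
  | .k₂ => B.torusTwo
  | .k₂inv => B.torusTwoInv
  | .e₁ => B.raiseOne
  | .e₂ => B.raiseTwo
  | .f₁ => lowerOne F W
  | .f₂ => lowerTwo W q

/-- The representation of the free algebra on the module induced from `B`. -/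
def freeRep : FreeAlgebra F Gen →ₐ[F] Module.End F (Tri W) := FreeAlgebra.lift F B.genOp

@[simp] theorem freeRep_gen (x : Gen) : B.freeRep (gen F x) = B.genOp x :=
  FreeAlgebra.lift_ι_apply _ _

theorem freeRep_rel (hq : q ≠ 0) (hq' : q ^ 2 - 1 ≠ 0) {x y : FreeAlgebra F Gen}
    (h : Rel F q x y) : B.freeRep x = B.freeRep y := by
  cases h <;> simp only [map_mul, map_add, map_sub, map_smul, map_neg, map_pow, map_one, map_zero,
    freeRep_gen, genOp]
  case k₁_mul_inv => exact B.torusOne_mul_inv hq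
  case k₁_inv_mul => exact B.torusOne_inv_mul hq
  case k₂_mul_inv => exact B.torusTwo_mul_inv hq
  case k₂_inv_mul => exact B.torusTwo_inv_mul hq
  case k₂_k₁ => exact B.torusTwo_mul_torusOne
  case e₁_k₁ => exact B.raiseOne_mul_torusOne hq hq'
  case e₂_k₁ => exact B.raiseTwo_mul_torusOne hq hq'
  case e₁_k₂ => exact B.raiseOne_mul_torusTwo hq hq'
  case e₂_k₂ => exact B.raiseTwo_mul_torusTwo hq hq'
  case k₁_f₁ => exact B.torusOne_mul_lowerOne hq
  case k₁_f₂ => exact B.torusOne_mul_lowerTwo hq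
  case k₂_f₁ => exact B.torusTwo_mul_lowerOne
  case k₂_f₂ => exact B.torusTwo_mul_lowerTwo hq
  case e₁_f₁ => exact B.raiseOne_mul_lowerOne hq hq'
  case e₂_f₂ => exact B.raiseTwo_mul_lowerTwo hq hq'
  case e₁_f₂ => exact B.raiseOne_mul_lowerTwo hq hq'
  case e₂_f₁ => exact B.raiseTwo_mul_lowerOne
  case e₂_sq => exact B.raiseTwo_sq hq hq'
  case f₂_sq => exact lowerTwo_sq q
  case e_serre => exact B.raise_serre hq hq'
  case f_serre => exact lower_serre hq hq'

/-- The representation of `U_q` induced from a representation of its nonnegative part. -/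
def rep (hq : q ≠ 0) (hq' : q ^ 2 - 1 ≠ 0) : Uq F q →ₐ[F] Module.End F (Tri W) :=
  RingQuot.liftAlgHom F ⟨B.freeRep, fun _ _ h => B.freeRep_rel hq hq' h⟩

theorem rep_proj (hq : q ≠ 0) (hq' : q ^ 2 - 1 ≠ 0) (x : FreeAlgebra F Gen) :
    B.rep hq hq' (Uq.proj q x) = B.freeRep x :=
  RingQuot.liftAlgHom_mkAlgHom_apply F _ _ x

end BorelRep

/-! ### Ordered monomials on the generating vector, and linear independence. -/

section Monomials

variable {F W : Type*} [Field F] [AddCommGroup W] [Module F W]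

/-- The action of an ordered monomial in operators satisfying the relations of `f₁, f₃, f₂` on the
top component. -/
theorem lower_monomial_apply {q : F} (hq : q ≠ 0) (hq' : q ^ 2 - 1 ≠ 0) (w : ℕ) (s l : Fin 2)
    (x : W) :
    (lowerOne F W ^ w) (((lowerTwo W q * lowerOne F W - q • (lowerOne F W * lowerTwo W q)) ^ (s : ℕ))
      ((lowerTwo W q ^ (l : ℕ)) (.single (0, 0, 0) x))) = .single (w, s, l) x := by
  have h (s l : Fin 2) : (lowerOne F W ^ w) (.single (0, s, l) x) = .single (w, s, l) x := by
    induction w with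
    | zero => rfl
    | succ w ih => rw [pow_succ', Module.End.mul_apply, ih, lowerOne_single]
  -- The powers of `f₁` only shift `w`, so the four cases of `(s, l)` at `w = 0` remain.
  rw [← h]
  congr 1
  match s, l with
  | 0, 0 => simp
  | 0, 1 => simp
  | 1, 0 => simp [-Finsupp.smul_single, qInt_one hq hq']
  | 1, 1 => simp [-Finsupp.smul_single, qInt_one hq hq']

end Monomials

namespace Uq

variable {F : Type*} [Field F] {q : F}

/-- The representation of `U_q` induced from the regular representation of its
nonnegative part. -/
def triRep (hq : q ≠ 0) (hq' : q ^ 2 - 1 ≠ 0) :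
    Uq F q →ₐ[F] Module.End F (Tri (Tri (Torus F))) :=
  (borelRegular hq hq').rep hq hq'

end Uq

/-- As `u` shifts the family `v` up to the scalar `c`, its inverse must shift it back; no separate
formula for `u⁻¹` is needed. -/
theorem apply_units_zpow {F A V : Type*} [Field F] [Ring A] [Algebra F A] [AddCommGroup V]
    [Module F V] (φ : A →ₐ[F] Module.End F V) (u : Aˣ) {c : F} (hc : c ≠ 0) {v : ℤ → V}
    (h : ∀ z, φ u (v z) = c • v (z + 1)) (i z : ℤ) :
    φ ((u ^ i : Aˣ) : A) (v z) = c ^ i • v (z + i) := by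
  have hinv (z : ℤ) : φ ((u⁻¹ : Aˣ) : A) (v z) = c⁻¹ • v (z - 1) := by
    have h₁ := h (z - 1)
    rw [sub_add_cancel] at h₁
    have h₂ : v z = c⁻¹ • φ u (v (z - 1)) := by rw [h₁, smul_smul, inv_mul_cancel₀ hc, one_smul]
    rw [h₂, map_smul, ← Module.End.mul_apply, ← map_mul, Units.inv_mul, map_one,
      Module.End.one_apply]
  induction i with
  | zero => simp
  | succ n ih =>
    rw [zpow_add_one₀ hc, add_comm (n : ℤ) 1, zpow_one_add, Units.val_mul, map_mul,
      Module.End.mul_apply, ih, map_smul, h, smul_smul]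
    congr 2
    ring
  | pred n ih =>
    rw [zpow_sub_one₀ hc, sub_eq_neg_add, zpow_add, zpow_neg_one, Units.val_mul, map_mul,
      Module.End.mul_apply, ih, map_smul, hinv, smul_smul]
    congr 2
    ring

namespace BorelRep

variable {F W : Type*} [Field F] [AddCommGroup W] [Module F W] {q : F} (B : BorelRep q W)

theorem raiseOne_pow_top (r : ℕ) (x : W) :
    (B.raiseOne ^ r) (.single (0, 0, 0) x) = .single (0, 0, 0) ((B.e₁ ^ r) x) := by
  induction r with
  | zero => rfl
  | succ r ih => rw [pow_succ', Module.End.mul_apply, ih, raiseOne_top, pow_succ',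
      Module.End.mul_apply]

theorem raiseTwo_pow_top (r : ℕ) (x : W) :
    (B.raiseTwo ^ r) (.single (0, 0, 0) x) = .single (0, 0, 0) ((B.e₂ ^ r) x) := by
  induction r with
  | zero => rfl
  | succ r ih => rw [pow_succ', Module.End.mul_apply, ih, raiseTwo_single₀₀, pow_succ',
      Module.End.mul_apply]

/-- Since `e₃ = -q⁻¹ (e₂e₁ - q e₁e₂)`, this puts `e₃` into the shape handled by
`lower_monomial_apply`. -/
theorem raiseThree_pow_top (hq : q ≠ 0) (h : Fin 2) (x : W) :
    ((B.raiseOne * B.raiseTwo - q⁻¹ • (B.raiseTwo * B.raiseOne)) ^ (h : ℕ))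
        (.single (0, 0, 0) x)
      = (-q⁻¹) ^ (h : ℕ) •
        .single (0, 0, 0) (((B.e₂ * B.e₁ - q • (B.e₁ * B.e₂)) ^ (h : ℕ)) x) := by
  match h with
  | 0 => simp
  | 1 =>
    simp [-raiseOne_single₀₀, raiseOne_top, smul_sub, smul_smul, hq, neg_add_eq_sub]

end BorelRep

namespace Uq

variable {F : Type*} [Field F] {q : F}

/-- The generating vector of the representation `triRep`. -/
def topVec (F : Type*) [Field F] : Tri (Tri (Torus F)) :=
  .single (0, 0, 0) (.single (0, 0, 0) (.single (0, 0) 1))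

/-- The nonzero scalar by which an ordered monomial in `k₁, k₂, e₁, e₃, e₂` differs from a basis
vector of the regular representation. -/
def monomialCoeff (q : F) (i j : ℤ) (r h t : ℕ) : F :=
  (-q⁻¹) ^ h * (wtTwo q⁻¹ r h t ^ j * wtOne q⁻¹ r h t ^ i)

theorem wtOne_ne_zero (hq : q ≠ 0) (w s l : ℕ) : wtOne q w s l ≠ 0 :=
  left_ne_zero_of_mul_eq_one (wtOne_mul_inv hq w s l)

theorem wtTwo_ne_zero (hq : q ≠ 0) (w s l : ℕ) : wtTwo q w s l ≠ 0 :=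
  left_ne_zero_of_mul_eq_one (wtTwo_mul_inv hq w s l)

theorem monomialCoeff_ne_zero (hq : q ≠ 0) (i j : ℤ) (r h t : ℕ) :
    monomialCoeff q i j r h t ≠ 0 :=
  mul_ne_zero (pow_ne_zero _ (neg_ne_zero.2 (inv_ne_zero hq)))
    (mul_ne_zero (zpow_ne_zero _ (wtTwo_ne_zero (inv_ne_zero hq) _ _ _))
      (zpow_ne_zero _ (wtOne_ne_zero (inv_ne_zero hq) _ _ _)))

section

variable (hq : q ≠ 0) (hq' : q ^ 2 - 1 ≠ 0)

theorem triRep_k₁ : triRep hq hq' (k₁ q : (Uq F q)ˣ) = (borelRegular hq hq').torusOne := by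
  rw [triRep, k₁, BorelRep.rep_proj, BorelRep.freeRep_gen, BorelRep.genOp]

theorem triRep_k₂ : triRep hq hq' (k₂ q : (Uq F q)ˣ) = (borelRegular hq hq').torusTwo := by
  rw [triRep, k₂, BorelRep.rep_proj, BorelRep.freeRep_gen, BorelRep.genOp]

theorem triRep_e₁ : triRep hq hq' (e₁ q) = (borelRegular hq hq').raiseOne := by
  rw [triRep, e₁, BorelRep.rep_proj, BorelRep.freeRep_gen, BorelRep.genOp]

theorem triRep_e₂ : triRep hq hq' (e₂ q) = (borelRegular hq hq').raiseTwo := by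
  rw [triRep, e₂, BorelRep.rep_proj, BorelRep.freeRep_gen, BorelRep.genOp]

theorem triRep_f₁ : triRep hq hq' (f₁ q) = lowerOne F _ := by
  rw [triRep, f₁, BorelRep.rep_proj, BorelRep.freeRep_gen, BorelRep.genOp]

theorem triRep_f₂ : triRep hq hq' (f₂ q) = lowerTwo _ q := by
  rw [triRep, f₂, BorelRep.rep_proj, BorelRep.freeRep_gen, BorelRep.genOp]

theorem triRep_k₁_zpow (i a b : ℤ) (r : ℕ) (h t : Fin 2) :
    triRep hq hq' ((k₁ q ^ i : (Uq F q)ˣ) : Uq F q)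
        (.single (0, 0, 0) (.single (r, h, t) (.single (a, b) 1)))
      = wtOne q⁻¹ r h t ^ i • .single (0, 0, 0) (.single (r, h, t) (.single (a + i, b) 1)) := by
  refine apply_units_zpow (triRep hq hq') (k₁ q) (wtOne_ne_zero (inv_ne_zero hq) _ _ _)
    (v := fun z => .single (0, 0, 0) (.single (r, h, t) (.single (z, b) 1))) (fun z => ?_) i a
  rw [triRep_k₁, BorelRep.torusOne_top, borelRegular, diagOp_single, torusShift_single,
    Prod.mk_add_mk, add_zero]
  simp only [Finsupp.smul_single]

theorem triRep_k₂_zpow (j a b : ℤ) (r : ℕ) (h t : Fin 2) :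
    triRep hq hq' ((k₂ q ^ j : (Uq F q)ˣ) : Uq F q)
        (.single (0, 0, 0) (.single (r, h, t) (.single (a, b) 1)))
      = wtTwo q⁻¹ r h t ^ j • .single (0, 0, 0) (.single (r, h, t) (.single (a, b + j) 1)) := by
  refine apply_units_zpow (triRep hq hq') (k₂ q) (wtTwo_ne_zero (inv_ne_zero hq) _ _ _)
    (v := fun z => .single (0, 0, 0) (.single (r, h, t) (.single (a, z) 1))) (fun z => ?_) j b
  rw [triRep_k₂, BorelRep.torusTwo_top, borelRegular, diagOp_single, torusShift_single,
    Prod.mk_add_mk, add_zero]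
  simp only [Finsupp.smul_single]

theorem triRep_monomial (w : ℕ) (s l : Fin 2) (i j : ℤ) (r : ℕ) (h t : Fin 2) :
    triRep hq hq' (monomial q (w, s, l, i, j, r, h, t)) (topVec F)
      = monomialCoeff q i j r h t •
        .single (w, s, l) (.single (r, h, t) (.single (i, j) 1)) := by
  -- In `borelRegular` the operators of `e₁, e₂` are by definition `lowerOne, lowerTwo`, so the
  -- computation for the `f` applies verbatim.
  have he : ((borelRegular hq hq').e₁ ^ r) ((((borelRegular hq hq').e₂ * (borelRegular hq hq').e₁
      - q • ((borelRegular hq hq').e₁ * (borelRegular hq hq').e₂)) ^ (h : ℕ))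
        (((borelRegular hq hq').e₂ ^ (t : ℕ)) (.single (0, 0, 0) (.single (0, 0) 1))))
      = .single (r, h, t) (.single (0, 0) 1) :=
    lower_monomial_apply hq hq' r h t _
  have hf := lower_monomial_apply hq hq' w s l
    (.single (r, h, t) (.single (i, j) 1) : Tri (Torus F))
  rw [monomial, e₃, f₃, topVec]
  simp only [map_mul, map_pow, map_sub, map_smul, triRep_e₁, triRep_e₂, triRep_f₁, triRep_f₂,
    Module.End.mul_apply]
  rw [BorelRep.raiseTwo_pow_top, BorelRep.raiseThree_pow_top _ hq, map_smul,
    BorelRep.raiseOne_pow_top]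
  simp only [map_smul]
  rw [he, triRep_k₂_zpow, map_smul, triRep_k₁_zpow]
  simp only [map_smul, zero_add]
  rw [hf, smul_smul, smul_smul, monomialCoeff, mul_assoc]

include hq hq' in
theorem linearIndependent_monomial : LinearIndependent F (monomial q) := by
  rw [linearIndependent_iff']
  rintro S g hg ⟨w, s, l, i, j, r, h, t⟩ hx
  -- Apply the relation to `topVec` and read off one coordinate: only one monomial contributes to
  -- it.
  have key := congrArg (fun a => triRep hq hq' a (topVec F) (w, s, l) (r, h, t) (i, j)) hg
  simp only [map_sum, map_smul, LinearMap.sum_apply, LinearMap.smul_apply, Finsupp.finsetSum_apply,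
    Finsupp.smul_apply, map_zero, LinearMap.zero_apply, Finsupp.zero_apply] at key
  rw [Finset.sum_eq_single_of_mem _ hx, triRep_monomial] at key
  · simpa [monomialCoeff_ne_zero hq] using key
  · rintro ⟨w', s', l', i', j', r', h', t'⟩ - hne
    rw [triRep_monomial, Finsupp.smul_apply, Finsupp.smul_apply, Finsupp.smul_apply]
    by_cases h₁ : (w, s, l) = (w', s', l')
    · by_cases h₂ : (r, h, t) = (r', h', t')
      · have h₃ : (i, j) ≠ (i', j') := by rintro h₃; simp_all
        rw [h₁, Finsupp.single_eq_same, h₂, Finsupp.single_eq_same, Finsupp.single_eq_of_ne h₃,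
          smul_zero, smul_zero]
      · rw [h₁, Finsupp.single_eq_same, Finsupp.single_eq_of_ne h₂, Finsupp.zero_apply, smul_zero,
          smul_zero]
    · rw [Finsupp.single_eq_of_ne h₁, Finsupp.zero_apply, Finsupp.zero_apply, smul_zero, smul_zero]

end

end Uq

/-! ### Spanning within one half. -/

section TriSpan

variable {F A : Type*} [Field F] [Ring A] [Algebra F A]

/-- The span of the ordered monomials `aʷ cˢ bˡ` with `s, l ∈ {0, 1}`. -/
def triSpan (F : Type*) {A : Type*} [Field F] [Ring A] [Algebra F A] (a c b : A) : Submodule F A :=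
  Submodule.span F (Set.range fun x : ℕ × Fin 2 × Fin 2 =>
    a ^ x.1 * (c ^ (x.2.1 : ℕ) * b ^ (x.2.2 : ℕ)))

theorem mem_triSpan (a c b : A) (w : ℕ) (s l : Fin 2) :
    a ^ w * (c ^ (s : ℕ) * b ^ (l : ℕ)) ∈ triSpan F a c b :=
  Submodule.subset_span ⟨(w, s, l), rfl⟩

theorem one_mem_triSpan (a c b : A) : (1 : A) ∈ triSpan F a c b := by
  simpa using mem_triSpan (F := F) a c b 0 0 0

theorem pow_mul_mem {S : Submodule F A} {a : A} (h : ∀ x ∈ S, a * x ∈ S) (n : ℕ) {x : A}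
    (hx : x ∈ S) : a ^ n * x ∈ S := by
  induction n with
  | zero => simpa using hx
  | succ n ih => rw [pow_succ', mul_assoc]; exact h _ ih

theorem triSpan_le {S : Submodule F A} {a b : A} (q : F) (h₁ : (1 : A) ∈ S)
    (ha : ∀ x ∈ S, a * x ∈ S) (hb : ∀ x ∈ S, b * x ∈ S) :
    triSpan F a (b * a - q • (a * b)) b ≤ S := by
  refine Submodule.span_le.2 ?_
  rintro _ ⟨⟨w, s, l⟩, rfl⟩
  refine pow_mul_mem ha _ (pow_mul_mem (fun x hx => ?_) _ ?_)
  · rw [sub_mul, smul_mul_assoc, mul_assoc, mul_assoc]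
    exact S.sub_mem (hb _ (ha _ hx)) (S.smul_mem _ (ha _ (hb _ hx)))
  · simpa using pow_mul_mem hb l h₁

theorem triSpan_mul_left {a c b x : A} (h : x ∈ triSpan F a c b) : a * x ∈ triSpan F a c b := by
  suffices triSpan F a c b ≤ (triSpan F a c b).comap (LinearMap.mulLeft F a) from this h
  refine Submodule.span_le.2 ?_
  rintro _ ⟨⟨w, s, l⟩, rfl⟩
  rw [SetLike.mem_coe, Submodule.mem_comap, LinearMap.mulLeft_apply, ← mul_assoc, ← pow_succ']
  exact mem_triSpan a c b (w + 1) s l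

theorem triSpan_mul_right {a c b : A} {q p : F} (hca : c * a = p • (a * c))
    (hbc : b * c = -(q • (c * b))) (hba : b * a = c + q • (a * b)) (hb : b * b = 0)
    (hc : c * c = 0) {x : A} (h : x ∈ triSpan F a c b) : b * x ∈ triSpan F a c b := by
  suffices triSpan F a c b ≤ (triSpan F a c b).comap (LinearMap.mulLeft F b) from this h
  have h₁ (w : ℕ) (s l : Fin 2) :
      a ^ w * (b * (c ^ (s : ℕ) * b ^ (l : ℕ))) ∈ triSpan F a c b := by
    match s, l with
    | 0, 0 => simpa using mem_triSpan (F := F) a c b w 0 1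
    | 0, 1 => simp [hb]
    | 1, 0 => simpa [hbc] using (triSpan F a c b).smul_mem q (mem_triSpan a c b w 1 1)
    | 1, 1 => simp [← mul_assoc b, hbc, mul_assoc, hb]
  have h₂ (w : ℕ) (s l : Fin 2) :
      a ^ w * (c * (c ^ (s : ℕ) * b ^ (l : ℕ))) ∈ triSpan F a c b := by
    match s with
    | 0 => simpa using mem_triSpan (F := F) a c b w 1 l
    | 1 => simp [← mul_assoc c, hc]
  -- For spanning, the value of `μ` is irrelevant.
  have h₃ (w : ℕ) : ∃ μ : F, b * a ^ (w + 1)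
      = q ^ (w + 1) • (a ^ (w + 1) * b) + μ • (a ^ w * c) := by
    induction w with
    | zero => exact ⟨1, by simp [hba, add_comm]⟩
    | succ w ih =>
      obtain ⟨μ, ih⟩ := ih
      refine ⟨q ^ (w + 1) + μ * p, ?_⟩
      rw [pow_succ a (w + 1), ← mul_assoc, ih, add_mul, smul_mul_assoc, smul_mul_assoc, mul_assoc,
        hba, mul_assoc (a ^ w), hca, mul_add, mul_smul_comm, mul_smul_comm, ← mul_assoc,
        ← mul_assoc, ← pow_succ a (w + 1), ← pow_succ a w]
      module
  refine Submodule.span_le.2 ?_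
  rintro _ ⟨⟨w, s, l⟩, rfl⟩
  rw [SetLike.mem_coe, Submodule.mem_comap, LinearMap.mulLeft_apply]
  rcases w with _ | w
  · simpa using h₁ 0 s l
  · obtain ⟨μ, h₃⟩ := h₃ w
    rw [← mul_assoc, h₃, add_mul, smul_mul_assoc, smul_mul_assoc, mul_assoc, mul_assoc]
    exact add_mem (Submodule.smul_mem _ _ (h₁ _ _ _)) (Submodule.smul_mem _ _ (h₂ _ _ _))

/-- The span of the ordered monomials in `a, b` is a left ideal of the subalgebra generated by
`a, b`, if these satisfy the quantum Serre relation and `b² = 0`. -/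
theorem triSpan_mul_right_of_serre {q : F} (hq : q ≠ 0) (hq' : q ^ 2 + 1 ≠ 0) {a b : A}
    (hb : b * b = 0) (hab : a ^ 2 * b - (q + q⁻¹) • (a * b * a) + b * a ^ 2 = 0) {x : A}
    (h : x ∈ triSpan F a (b * a - q • (a * b)) b) :
    b * x ∈ triSpan F a (b * a - q • (a * b)) b := by
  have hbb (y : A) : b * (b * y) = 0 := by rw [← mul_assoc, hb, zero_mul]
  -- The Serre relation, rewritten.
  have hca : (b * a - q • (a * b)) * a = q⁻¹ • (a * (b * a - q • (a * b))) := by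
    rw [← sub_eq_zero, ← hab]
    simp only [sub_mul, mul_sub, smul_mul_assoc, mul_smul_comm, sq, mul_assoc]
    match_scalars <;> field_simp
    ring
  have hbc : b * (b * a - q • (a * b)) = -(q • ((b * a - q • (a * b)) * b)) := by
    simp only [sub_mul, mul_sub, smul_mul_assoc, mul_smul_comm, mul_assoc, hb, hbb]
    simp
  refine triSpan_mul_right hca hbc (by simp) hb ?_ h
  set c := b * a - q • (a * b) with hc
  have hcb : c * b = -(q⁻¹ • (b * c)) := by
    rw [hbc, smul_neg, smul_smul, inv_mul_cancel₀ hq, one_smul, neg_neg]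
  -- Expand the right factor `c` and move the left one past `a` and `b`: each passage costs `q⁻¹`,
  -- and that of `b` also a sign. Hence `(1 + q⁻²) c² = 0`.
  have h₁ : c * c = -(q⁻¹ ^ 2 • (c * c)) := by
    have e₁ : c * (b * a) = -(q⁻¹ ^ 2 • (b * a * c)) := by
      rw [← mul_assoc, hcb, neg_mul, smul_mul_assoc, mul_assoc, hca, mul_smul_comm, smul_smul,
        ← sq, mul_assoc]
    have e₂ : c * (a * b) = -(q⁻¹ ^ 2 • (a * b * c)) := by
      rw [← mul_assoc, hca, smul_mul_assoc, mul_assoc, hcb, mul_neg, mul_smul_comm, smul_neg,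
        smul_smul, ← sq, mul_assoc]
    calc c * c = c * (b * a) - q • (c * (a * b)) := by rw [← mul_smul_comm, ← mul_sub, ← hc]
      _ = -(q⁻¹ ^ 2 • ((b * a - q • (a * b)) * c)) := by
        rw [e₁, e₂, sub_mul, smul_mul_assoc]; module
      _ = _ := by rw [← hc]
  have h₂ : (1 + q⁻¹ ^ 2) • (c * c) = 0 := by
    rw [add_smul, one_smul]; nth_rw 1 [h₁]; simp
  refine (smul_eq_zero.1 h₂).resolve_left fun h => hq' ?_
  field_simp at h
  simpa using h

end TriSpan

/-- Stated with products of submodules, moving an element past several factors becomes a chain of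
inequalities. -/
theorem span_singleton_mul_le {F A : Type*} [Field F] [Ring A] [Algebra F A] {x : A}
    {S R : Submodule F A} (h : ∀ y ∈ S, x * y ∈ R) : Submodule.span F {x} * S ≤ R := by
  refine Submodule.mul_le.2 fun m hm y hy => ?_
  obtain ⟨c, rfl⟩ := Submodule.mem_span_singleton.1 hm
  rw [smul_mul_assoc]
  exact R.smul_mem _ (h y hy)

theorem mul_mem_of_span_singleton_mul_le {F A : Type*} [Field F] [Ring A] [Algebra F A] {x y : A}
    {S R : Submodule F A} (h : Submodule.span F {x} * S ≤ R) (hy : y ∈ S) : x * y ∈ R :=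
  h (Submodule.mul_mem_mul (Submodule.mem_span_singleton_self x) hy)

/-! ### The span of the torus. -/

section TorusSpan

variable {F A : Type*} [Field F] [Ring A] [Algebra F A]

/-- The span of the monomials `k₁ⁱ k₂ʲ`. -/
def torusSpan (F : Type*) {A : Type*} [Field F] [Ring A] [Algebra F A] (k₁ k₂ : Aˣ) :
    Submodule F A :=
  Submodule.span F (Set.range fun x : ℤ × ℤ => ((k₁ ^ x.1 * k₂ ^ x.2 : Aˣ) : A))

theorem mem_torusSpan (k₁ k₂ : Aˣ) (i j : ℤ) :
    ((k₁ ^ i * k₂ ^ j : Aˣ) : A) ∈ torusSpan F k₁ k₂ :=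
  Submodule.subset_span ⟨(i, j), rfl⟩

theorem zpow_mul_mem {S : Submodule F A} {k : Aˣ} (h : ∀ x ∈ S, (k : A) * x ∈ S)
    (h' : ∀ x ∈ S, ((k⁻¹ : Aˣ) : A) * x ∈ S) (n : ℤ) {x : A} (hx : x ∈ S) :
    ((k ^ n : Aˣ) : A) * x ∈ S := by
  induction n with
  | zero => simpa using hx
  | succ n ih =>
    rw [add_comm, zpow_one_add, Units.val_mul, mul_assoc]; exact h _ ih
  | pred n ih =>
    rw [sub_eq_neg_add, zpow_add, zpow_neg_one, Units.val_mul, mul_assoc]; exact h' _ ih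

theorem torusSpan_le {S : Submodule F A} {k₁ k₂ : Aˣ} (h : (1 : A) ∈ S)
    (h₁ : ∀ x ∈ S, (k₁ : A) * x ∈ S) (h₁' : ∀ x ∈ S, ((k₁⁻¹ : Aˣ) : A) * x ∈ S)
    (h₂ : ∀ x ∈ S, (k₂ : A) * x ∈ S) (h₂' : ∀ x ∈ S, ((k₂⁻¹ : Aˣ) : A) * x ∈ S) :
    torusSpan F k₁ k₂ ≤ S := by
  refine Submodule.span_le.2 ?_
  rintro _ ⟨⟨i, j⟩, rfl⟩
  dsimp only
  rw [Units.val_mul]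
  refine zpow_mul_mem h₁ h₁' i ?_
  simpa using zpow_mul_mem h₂ h₂' j h

theorem torusSpan_mul_self {k₁ k₂ : Aˣ} (h : Commute k₁ k₂) :
    torusSpan F k₁ k₂ * torusSpan F k₁ k₂ ≤ torusSpan F k₁ k₂ := by
  rw [torusSpan, Submodule.span_mul_span, ← torusSpan, Submodule.span_le]
  rintro _ ⟨_, ⟨⟨i, j⟩, rfl⟩, _, ⟨⟨i', j'⟩, rfl⟩, rfl⟩
  have e : k₁ ^ i * k₂ ^ j * (k₁ ^ i' * k₂ ^ j') = k₁ ^ (i + i') * k₂ ^ (j + j') := by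
    rw [mul_assoc, ← mul_assoc (k₂ ^ j), ← (h.zpow_zpow i' j).eq, zpow_add, zpow_add]
    simp only [mul_assoc]
  dsimp only
  rw [← Units.val_mul, e]
  exact mem_torusSpan _ _ _ _

/-- An element that skew-commutes with a pair of units can be moved past their monomials. -/
theorem span_singleton_mul_torusSpan_le {k₁ k₂ : Aˣ} {x : A} {a b : F} (ha : a ≠ 0) (hb : b ≠ 0)
    (hk : Commute k₁ k₂)
    (h₁ : x * k₁ = a • (k₁ * x)) (h₂ : x * k₂ = b • (k₂ * x)) :
    Submodule.span F {x} * torusSpan F k₁ k₂ ≤ torusSpan F k₁ k₂ * Submodule.span F {x} := by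
  refine span_singleton_mul_le fun y hy => ?_
  suffices torusSpan F k₁ k₂
      ≤ (torusSpan F k₁ k₂ * Submodule.span F {x}).comap (LinearMap.mulLeft F x) from this hy
  have step {k : Aˣ} {c : F} (hkT : (k : A) ∈ torusSpan F k₁ k₂) (h : x * k = c • (k * x)) (y : A)
      (hy : x * y ∈ torusSpan F k₁ k₂ * Submodule.span F {x}) :
      x * (k * y) ∈ torusSpan F k₁ k₂ * Submodule.span F {x} := by
    rw [← mul_assoc, h, smul_mul_assoc, mul_assoc]
    refine Submodule.smul_mem _ _ ?_
    have := Submodule.mul_mem_mul hkT hy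
    rw [← mul_assoc] at this
    exact mul_le_mul_left (torusSpan_mul_self hk) _ this
  have h₁' := mul_inv_of_skew_comm k₁.mul_inv k₁.inv_mul ha h₁
  have h₂' := mul_inv_of_skew_comm k₂.mul_inv k₂.inv_mul hb h₂
  refine torusSpan_le ?_ (step ?_ h₁) (step ?_ h₁') (step ?_ h₂) (step ?_ h₂')
  · rw [Submodule.mem_comap, LinearMap.mulLeft_apply, mul_one]
    simpa using Submodule.mul_mem_mul (mem_torusSpan (F := F) k₁ k₂ 0 0)
      (Submodule.mem_span_singleton_self (R := F) x)
  · simpa using mem_torusSpan (F := F) k₁ k₂ 1 0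
  · simpa using mem_torusSpan (F := F) k₁ k₂ (-1) 0
  · simpa using mem_torusSpan (F := F) k₁ k₂ 0 1
  · simpa using mem_torusSpan (F := F) k₁ k₂ 0 (-1)

end TorusSpan

/-! ### The triangular decomposition of `U_q` and spanning. -/

namespace Uq

variable {F : Type*} [Field F]

section Relations

variable (q : F)

theorem k₂_mul_k₁ : Commute (k₁ q) (k₂ q) :=
  Units.ext <| by
    have h := proj_eq_of_rel q .k₂_k₁
    simp only [map_mul] at h
    exact h.symm

theorem e₁_mul_k₁ : e₁ q * k₁ q = q⁻¹ ^ 2 • (k₁ q * e₁ q) := by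
  have h := proj_eq_of_rel q .e₁_k₁
  simp only [map_mul, map_smul] at h
  exact h

theorem e₂_mul_k₁ : e₂ q * k₁ q = q • (k₁ q * e₂ q) := by
  have h := proj_eq_of_rel q .e₂_k₁
  simp only [map_mul, map_smul] at h
  exact h

theorem e₁_mul_k₂ : e₁ q * k₂ q = q • (k₂ q * e₁ q) := by
  have h := proj_eq_of_rel q .e₁_k₂
  simp only [map_mul, map_smul] at h
  exact h

theorem e₂_mul_k₂ : e₂ q * k₂ q = k₂ q * e₂ q := by
  have h := proj_eq_of_rel q .e₂_k₂
  simp only [map_mul] at h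
  exact h

theorem k₁_mul_f₁ : k₁ q * f₁ q = q⁻¹ ^ 2 • (f₁ q * k₁ q) := by
  have h := proj_eq_of_rel q .k₁_f₁
  simp only [map_mul, map_smul] at h
  exact h

theorem k₁_mul_f₂ : k₁ q * f₂ q = q • (f₂ q * k₁ q) := by
  have h := proj_eq_of_rel q .k₁_f₂
  simp only [map_mul, map_smul] at h
  exact h

theorem k₂_mul_f₁ : k₂ q * f₁ q = q • (f₁ q * k₂ q) := by
  have h := proj_eq_of_rel q .k₂_f₁
  simp only [map_mul, map_smul] at h
  exact h

theorem k₂_mul_f₂ : k₂ q * f₂ q = f₂ q * k₂ q := by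
  have h := proj_eq_of_rel q .k₂_f₂
  simp only [map_mul] at h
  exact h

theorem e₁_mul_f₁ : e₁ q * f₁ q = f₁ q * e₁ q
    + (q - q⁻¹)⁻¹ • ((k₁ q : Uq F q) - ((k₁ q)⁻¹ : (Uq F q)ˣ)) := by
  have h := proj_eq_of_rel q .e₁_f₁
  rwa [map_add, map_smul, map_sub, map_mul, map_mul] at h

theorem e₂_mul_f₂ : e₂ q * f₂ q = -(f₂ q * e₂ q)
    + (q - q⁻¹)⁻¹ • ((k₂ q : Uq F q) - ((k₂ q)⁻¹ : (Uq F q)ˣ)) := by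
  have h := proj_eq_of_rel q .e₂_f₂
  rwa [map_add, map_smul, map_sub, map_neg, map_mul, map_mul] at h

theorem e₁_mul_f₂ : e₁ q * f₂ q = f₂ q * e₁ q := by
  have h := proj_eq_of_rel q .e₁_f₂
  simp only [map_mul] at h
  exact h

theorem e₂_mul_f₁ : e₂ q * f₁ q = f₁ q * e₂ q := by
  have h := proj_eq_of_rel q .e₂_f₁
  simp only [map_mul] at h
  exact h

theorem e₂_mul_e₂ : e₂ q * e₂ q = 0 := by
  have h := proj_eq_of_rel q .e₂_sq
  simp only [map_mul, map_zero, sq] at h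
  exact h

theorem f₂_mul_f₂ : f₂ q * f₂ q = 0 := by
  have h := proj_eq_of_rel q .f₂_sq
  simp only [map_mul, map_zero, sq] at h
  exact h

theorem e_serre : e₁ q ^ 2 * e₂ q - (q + q⁻¹) • (e₁ q * e₂ q * e₁ q) + e₂ q * e₁ q ^ 2 = 0 := by
  have h := proj_eq_of_rel q .e_serre
  simp only [map_mul, map_pow, map_add, map_sub, map_smul, map_zero] at h
  exact h

theorem f_serre : f₁ q ^ 2 * f₂ q - (q + q⁻¹) • (f₁ q * f₂ q * f₁ q) + f₂ q * f₁ q ^ 2 = 0 := by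
  have h := proj_eq_of_rel q .f_serre
  simp only [map_mul, map_pow, map_add, map_sub, map_smul, map_zero] at h
  exact h

end Relations

/-- The span of the ordered monomials in `f₁, f₃, f₂`. -/
abbrev lowerSpan (q : F) : Submodule F (Uq F q) := triSpan F (f₁ q) (f₃ q) (f₂ q)

/-- The span of the ordered monomials in `e₁, e₃, e₂`. -/
abbrev upperSpan (q : F) : Submodule F (Uq F q) :=
  -- The middle element is `-q e₃` for `q ≠ 0`; in this form both halves fall under the same Serre
  -- argument.
  triSpan F (e₁ q) (e₂ q * e₁ q - q • (e₁ q * e₂ q)) (e₂ q)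

/-- The span of the monomials in `k₁, k₂`. -/
abbrev cartanSpan (q : F) : Submodule F (Uq F q) := torusSpan F (k₁ q) (k₂ q)

/-- The product of the three spans. -/
def triangularSpan (q : F) : Submodule F (Uq F q) := lowerSpan q * cartanSpan q * upperSpan q

variable {q : F}

theorem f₁_mul_mem_lowerSpan {x : Uq F q} (h : x ∈ lowerSpan q) : f₁ q * x ∈ lowerSpan q :=
  triSpan_mul_left h

theorem f₂_mul_mem_lowerSpan (hq : q ≠ 0) (hq' : q ^ 2 + 1 ≠ 0) {x : Uq F q}
    (h : x ∈ lowerSpan q) : f₂ q * x ∈ lowerSpan q :=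
  triSpan_mul_right_of_serre hq hq' (f₂_mul_f₂ q) (f_serre q) h

theorem e₁_mul_mem_upperSpan {x : Uq F q} (h : x ∈ upperSpan q) : e₁ q * x ∈ upperSpan q :=
  triSpan_mul_left h

theorem e₂_mul_mem_upperSpan (hq : q ≠ 0) (hq' : q ^ 2 + 1 ≠ 0) {x : Uq F q}
    (h : x ∈ upperSpan q) : e₂ q * x ∈ upperSpan q :=
  triSpan_mul_right_of_serre hq hq' (e₂_mul_e₂ q) (e_serre q) h

theorem cartanSpan_mul_self : cartanSpan q * cartanSpan q ≤ cartanSpan q :=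
  torusSpan_mul_self (k₂_mul_k₁ q)

theorem mul_mem_lowerSpan_mul {x : Uq F q} (h : ∀ y ∈ lowerSpan q, x * y ∈ lowerSpan q)
    {S : Submodule F (Uq F q)} {y : Uq F q} (hy : y ∈ lowerSpan q * S) :
    x * y ∈ lowerSpan q * S := by
  have := Submodule.mul_mem_mul (Submodule.mem_span_singleton_self (R := F) x) hy
  rw [← mul_assoc] at this
  exact mul_le_mul_left (span_singleton_mul_le h) _ this

theorem cartan_mul_lowerSpan_le (hq : q ≠ 0) (hq' : q ^ 2 + 1 ≠ 0) {k : Uq F q}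
    (hk : k ∈ cartanSpan q) {a b : F}
    (h₁ : k * f₁ q = a • (f₁ q * k)) (h₂ : k * f₂ q = b • (f₂ q * k)) :
    Submodule.span F {k} * lowerSpan q ≤ lowerSpan q * cartanSpan q := by
  refine span_singleton_mul_le fun y hy => ?_
  suffices lowerSpan q ≤ (lowerSpan q * cartanSpan q).comap (LinearMap.mulLeft F k) from this hy
  refine triSpan_le q ?_ (fun x hx => ?_) (fun x hx => ?_)
  · simpa using Submodule.mul_mem_mul (one_mem_triSpan _ _ _ : (1 : Uq F q) ∈ lowerSpan q) hk
  · rw [Submodule.mem_comap, LinearMap.mulLeft_apply, ← mul_assoc, h₁, smul_mul_assoc, mul_assoc]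
    exact Submodule.smul_mem _ _ (mul_mem_lowerSpan_mul (fun _ => f₁_mul_mem_lowerSpan) hx)
  · rw [Submodule.mem_comap, LinearMap.mulLeft_apply, ← mul_assoc, h₂, smul_mul_assoc, mul_assoc]
    exact Submodule.smul_mem _ _ (mul_mem_lowerSpan_mul (fun _ => f₂_mul_mem_lowerSpan hq hq') hx)

theorem k₁_mul_lowerSpan_le (hq : q ≠ 0) (hq' : q ^ 2 + 1 ≠ 0) :
    Submodule.span F {(k₁ q : Uq F q)} * lowerSpan q ≤ lowerSpan q * cartanSpan q :=
  cartan_mul_lowerSpan_le hq hq' (by simpa using mem_torusSpan (k₁ q) (k₂ q) 1 0)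
    (k₁_mul_f₁ q) (k₁_mul_f₂ q)

theorem k₂_mul_lowerSpan_le (hq : q ≠ 0) (hq' : q ^ 2 + 1 ≠ 0) :
    Submodule.span F {(k₂ q : Uq F q)} * lowerSpan q ≤ lowerSpan q * cartanSpan q :=
  cartan_mul_lowerSpan_le hq hq' (by simpa using mem_torusSpan (k₁ q) (k₂ q) 0 1)
    (k₂_mul_f₁ q) ((k₂_mul_f₂ q).trans (one_smul F _).symm)

theorem k₁_inv_mul_lowerSpan_le (hq : q ≠ 0) (hq' : q ^ 2 + 1 ≠ 0) :
    Submodule.span F {(((k₁ q)⁻¹ : (Uq F q)ˣ) : Uq F q)} * lowerSpan q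
      ≤ lowerSpan q * cartanSpan q :=
  cartan_mul_lowerSpan_le hq hq' (by simpa using mem_torusSpan (k₁ q) (k₂ q) (-1) 0)
    (inv_mul_of_skew_comm (k₁ q).mul_inv (k₁ q).inv_mul (by positivity) (k₁_mul_f₁ q))
    (inv_mul_of_skew_comm (k₁ q).mul_inv (k₁ q).inv_mul hq (k₁_mul_f₂ q))

theorem k₂_inv_mul_lowerSpan_le (hq : q ≠ 0) (hq' : q ^ 2 + 1 ≠ 0) :
    Submodule.span F {(((k₂ q)⁻¹ : (Uq F q)ˣ) : Uq F q)} * lowerSpan q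
      ≤ lowerSpan q * cartanSpan q :=
  cartan_mul_lowerSpan_le hq hq' (by simpa using mem_torusSpan (k₁ q) (k₂ q) 0 (-1))
    (inv_mul_of_skew_comm (k₂ q).mul_inv (k₂ q).inv_mul hq (k₂_mul_f₁ q))
    (inv_mul_of_skew_comm (k₂ q).mul_inv (k₂ q).inv_mul one_ne_zero
      ((k₂_mul_f₂ q).trans (one_smul F _).symm))

/-- An element that commutes with `f₁, f₂` up to sign and elements `h₁, h₂` of the Cartan part can
be moved past the lower part, up to the Cartan part. -/
theorem raise_mul_lowerSpan_le (hq : q ≠ 0) (hq' : q ^ 2 + 1 ≠ 0) {e h₁ h₂ : Uq F q} {a b : F}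
    (hh₁ : ∀ y ∈ lowerSpan q, h₁ * y ∈ lowerSpan q * cartanSpan q)
    (hh₂ : ∀ y ∈ lowerSpan q, h₂ * y ∈ lowerSpan q * cartanSpan q)
    (he₁ : e * f₁ q = a • (f₁ q * e) + h₁) (he₂ : e * f₂ q = b • (f₂ q * e) + h₂) :
    Submodule.span F {e} * lowerSpan q ≤ lowerSpan q * (Submodule.span F {e} ⊔ cartanSpan q) := by
  refine span_singleton_mul_le fun y hy => ?_
  -- The induction must also carry membership in `lowerSpan q`, which the correction terms `h₁ x`
  -- and `h₂ x` require.
  suffices lowerSpan q ≤ lowerSpan q ⊓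
      (lowerSpan q * (Submodule.span F {e} ⊔ cartanSpan q)).comap (LinearMap.mulLeft F e) from
    (this hy).2
  have hR : lowerSpan q * cartanSpan q ≤ lowerSpan q * (Submodule.span F {e} ⊔ cartanSpan q) :=
    mul_le_mul_right le_sup_right _
  refine triSpan_le q ⟨one_mem_triSpan _ _ _, ?_⟩ (fun x hx => ⟨f₁_mul_mem_lowerSpan hx.1, ?_⟩)
    (fun x hx => ⟨f₂_mul_mem_lowerSpan hq hq' hx.1, ?_⟩)
  · simpa using Submodule.mul_mem_mul (one_mem_triSpan _ _ _ : (1 : Uq F q) ∈ lowerSpan q)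
      (Submodule.mem_sup_left (T := cartanSpan q) (Submodule.mem_span_singleton_self (R := F) e))
  · rw [SetLike.mem_coe, Submodule.mem_comap, LinearMap.mulLeft_apply, ← mul_assoc, he₁, add_mul,
      smul_mul_assoc, mul_assoc]
    exact add_mem (Submodule.smul_mem _ _
      (mul_mem_lowerSpan_mul (fun _ => f₁_mul_mem_lowerSpan) hx.2)) (hR (hh₁ x hx.1))
  · rw [SetLike.mem_coe, Submodule.mem_comap, LinearMap.mulLeft_apply, ← mul_assoc, he₂, add_mul,
      smul_mul_assoc, mul_assoc]
    exact add_mem (Submodule.smul_mem _ _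
      (mul_mem_lowerSpan_mul (fun _ => f₂_mul_mem_lowerSpan hq hq') hx.2)) (hR (hh₂ x hx.1))

theorem cartan_mul_triangularSpan_le {k : Uq F q}
    (h : Submodule.span F {k} * lowerSpan q ≤ lowerSpan q * cartanSpan q) :
    Submodule.span F {k} * triangularSpan q ≤ triangularSpan q := by
  calc Submodule.span F {k} * triangularSpan q
      = Submodule.span F {k} * lowerSpan q * cartanSpan q * upperSpan q := by
        simp only [triangularSpan, mul_assoc]
    _ ≤ lowerSpan q * cartanSpan q * cartanSpan q * upperSpan q := by gcongr
    _ = lowerSpan q * (cartanSpan q * cartanSpan q) * upperSpan q := by rw [mul_assoc (lowerSpan q)]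
    _ ≤ triangularSpan q := by rw [triangularSpan]; gcongr; exact cartanSpan_mul_self

/-- Passing the lower part, `e` either survives or turns into a Cartan element. A surviving `e`
crosses the Cartan part and is absorbed by the upper one. -/
theorem raise_mul_triangularSpan_le {e : Uq F q}
    (h : Submodule.span F {e} * lowerSpan q
      ≤ lowerSpan q * (Submodule.span F {e} ⊔ cartanSpan q))
    (h₁ : Submodule.span F {e} * cartanSpan q ≤ cartanSpan q * Submodule.span F {e})
    (h₂ : Submodule.span F {e} * upperSpan q ≤ upperSpan q) :
    Submodule.span F {e} * triangularSpan q ≤ triangularSpan q := by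
  have h₃ : Submodule.span F {e} * cartanSpan q * upperSpan q ≤ cartanSpan q * upperSpan q := by
    calc _ ≤ cartanSpan q * Submodule.span F {e} * upperSpan q := by gcongr
      _ = cartanSpan q * (Submodule.span F {e} * upperSpan q) := mul_assoc _ _ _
      _ ≤ _ := by gcongr
  calc Submodule.span F {e} * triangularSpan q
      = Submodule.span F {e} * lowerSpan q * cartanSpan q * upperSpan q := by
        simp only [triangularSpan, mul_assoc]
    _ ≤ lowerSpan q * (Submodule.span F {e} ⊔ cartanSpan q) * cartanSpan q * upperSpan q := by
        gcongr
    _ = lowerSpan q * (Submodule.span F {e} * cartanSpan q * upperSpan q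
          ⊔ cartanSpan q * cartanSpan q * upperSpan q) := by
        rw [← Submodule.sup_mul, ← Submodule.sup_mul, mul_assoc, mul_assoc, mul_assoc]
    _ ≤ lowerSpan q * (cartanSpan q * upperSpan q) := by
        gcongr
        refine sup_le h₃ ?_
        gcongr
        exact cartanSpan_mul_self
    _ = triangularSpan q := by rw [triangularSpan, mul_assoc]

theorem proj_gen_mul_mem_triangularSpan (hq : q ≠ 0) (hq' : q ^ 2 + 1 ≠ 0) (g : Gen) {x : Uq F q}
    (hx : x ∈ triangularSpan q) : proj q (gen F g) * x ∈ triangularSpan q := by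
  have hcomm := k₂_mul_k₁ q
  have hk₁ := k₁_mul_lowerSpan_le hq hq'
  have hk₂ := k₂_mul_lowerSpan_le hq hq'
  have hk₁' := k₁_inv_mul_lowerSpan_le hq hq'
  have hk₂' := k₂_inv_mul_lowerSpan_le hq hq'
  have hh {k k' : Uq F q} (h : Submodule.span F {k} * lowerSpan q ≤ lowerSpan q * cartanSpan q)
      (h' : Submodule.span F {k'} * lowerSpan q ≤ lowerSpan q * cartanSpan q) (c : F) (y : Uq F q)
      (hy : y ∈ lowerSpan q) : (c • (k - k')) * y ∈ lowerSpan q * cartanSpan q := by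
    rw [smul_mul_assoc, sub_mul]
    exact Submodule.smul_mem _ _ (sub_mem (mul_mem_of_span_singleton_mul_le h hy)
      (mul_mem_of_span_singleton_mul_le h' hy))
  cases g
  case k₁ => exact mul_mem_of_span_singleton_mul_le (cartan_mul_triangularSpan_le hk₁) hx
  case k₁inv => exact mul_mem_of_span_singleton_mul_le (cartan_mul_triangularSpan_le hk₁') hx
  case k₂ => exact mul_mem_of_span_singleton_mul_le (cartan_mul_triangularSpan_le hk₂) hx
  case k₂inv => exact mul_mem_of_span_singleton_mul_le (cartan_mul_triangularSpan_le hk₂') hx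
  case f₁ =>
    rw [triangularSpan, mul_assoc] at hx ⊢
    exact mul_mem_lowerSpan_mul (fun _ => f₁_mul_mem_lowerSpan) hx
  case f₂ =>
    rw [triangularSpan, mul_assoc] at hx ⊢
    exact mul_mem_lowerSpan_mul (fun _ => f₂_mul_mem_lowerSpan hq hq') hx
  case e₁ =>
    refine mul_mem_of_span_singleton_mul_le (raise_mul_triangularSpan_le
      (raise_mul_lowerSpan_le hq hq' (a := 1) (b := 1) (h₂ := 0) (hh hk₁ hk₁' (q - q⁻¹)⁻¹) (by simp)
        ?_ ?_)
      (span_singleton_mul_torusSpan_le (by positivity) hq hcomm (e₁_mul_k₁ q) (e₁_mul_k₂ q))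
      (span_singleton_mul_le fun _ => e₁_mul_mem_upperSpan)) hx
    · rw [one_smul]; exact e₁_mul_f₁ q
    · rw [one_smul, add_zero]; exact e₁_mul_f₂ q
  case e₂ =>
    refine mul_mem_of_span_singleton_mul_le (raise_mul_triangularSpan_le
      (raise_mul_lowerSpan_le hq hq' (a := 1) (b := -1) (h₁ := 0) (by simp) (hh hk₂ hk₂' (q - q⁻¹)⁻¹)
        ?_ ?_)
      (span_singleton_mul_torusSpan_le hq one_ne_zero hcomm (e₂_mul_k₁ q)
        ((e₂_mul_k₂ q).trans (one_smul F _).symm))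
      (span_singleton_mul_le fun _ => e₂_mul_mem_upperSpan hq hq')) hx
    · rw [one_smul, add_zero]; exact e₂_mul_f₁ q
    · rw [neg_smul, one_smul]; exact e₂_mul_f₂ q

theorem proj_surjective (q : F) : Function.Surjective (proj q) := RingQuot.mkAlgHom_surjective F _

theorem triangularSpan_eq_top (hq : q ≠ 0) (hq' : q ^ 2 + 1 ≠ 0) : triangularSpan q = ⊤ := by
  have h₁ : (1 : Uq F q) ∈ triangularSpan q := by
    rw [triangularSpan]
    simpa using Submodule.mul_mem_mul (Submodule.mul_mem_mul
      (one_mem_triSpan _ _ _ : (1 : Uq F q) ∈ lowerSpan q) (mem_torusSpan (k₁ q) (k₂ q) 0 0))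
      (one_mem_triSpan _ _ _ : (1 : Uq F q) ∈ upperSpan q)
  refine Submodule.eq_top_iff'.2 fun x => ?_
  obtain ⟨x, rfl⟩ := proj_surjective q x
  suffices ∀ y ∈ triangularSpan q, proj q x * y ∈ triangularSpan q by simpa using this 1 h₁
  induction x with
  | grade0 r =>
    intro y hy
    rw [AlgHom.commutes, ← Algebra.smul_def]
    exact Submodule.smul_mem _ _ hy
  | grade1 g => exact fun y hy => proj_gen_mul_mem_triangularSpan hq hq' g hy
  | mul a b ha hb => intro y hy; rw [map_mul, mul_assoc]; exact ha _ (hb _ hy)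
  | add a b ha hb => intro y hy; rw [map_add, add_mul]; exact add_mem (ha _ hy) (hb _ hy)

theorem span_monomial_eq_top (hq : q ≠ 0) (hq' : q ^ 2 + 1 ≠ 0) :
    Submodule.span F (Set.range (monomial q)) = ⊤ := by
  rw [eq_top_iff, ← triangularSpan_eq_top hq hq', triangularSpan, lowerSpan, cartanSpan, upperSpan,
    triSpan, torusSpan, triSpan, Submodule.span_mul_span, Submodule.span_mul_span,
    Submodule.span_le]
  rintro _ ⟨_, ⟨_, ⟨⟨w, s, l⟩, rfl⟩, _, ⟨⟨i, j⟩, rfl⟩, rfl⟩, _, ⟨⟨r, h, t⟩, rfl⟩, rfl⟩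
  have he : e₂ q * e₁ q - q • (e₁ q * e₂ q) = (-q) • e₃ q := by
    rw [e₃, smul_sub, smul_smul, neg_mul, mul_inv_cancel₀ hq]
    module
  have : monomial q (w, s, l, i, j, r, h, t) ∈ Submodule.span F (Set.range (monomial q)) :=
    Submodule.subset_span ⟨_, rfl⟩
  rw [SetLike.mem_coe]
  -- The factor accounts for `-q e₃` in place of `e₃` in `upperSpan`.
  convert Submodule.smul_mem _ ((-q) ^ (h : ℕ)) this using 1
  dsimp only
  rw [he, smul_pow, monomial, Units.val_mul]
  simp only [smul_mul_assoc, mul_smul_comm, mul_assoc]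

end Uq

end

end QuantumSl21

theorem mainTheorem4 {k F : Type*} [Field k] [CharZero k] [Field F] [Algebra k F]
    (q : F) (hq : Transcendental k q)
    (hF : IsFractionRing (Algebra.adjoin k ({q, q⁻¹} : Set F)) F) :
    ∃ b : Module.Basis (ℕ × Fin 2 × Fin 2 × ℤ × ℤ × ℕ × Fin 2 × Fin 2) F (QuantumSl21.Uq F q),
      ∀ x, b x = QuantumSl21.Uq.monomial q x := by
  have h₀ : q ≠ 0 := by
    rintro rfl
    exact hq isAlgebraic_zero
  -- `h₁` serves linear independence and `h₂` spanning.
  have h₁ : q ^ 2 - 1 ≠ 0 := fun h => hq ⟨.X ^ 2 - .C 1, Polynomial.X_pow_sub_C_ne_zero two_pos 1,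
    by simpa using h⟩
  have h₂ : q ^ 2 + 1 ≠ 0 := fun h => hq ⟨.X ^ 2 + .C 1, Polynomial.X_pow_add_C_ne_zero two_pos 1,
    by simpa using h⟩
  exact ⟨.mk (QuantumSl21.Uq.linearIndependent_monomial h₀ h₁)
    (QuantumSl21.Uq.span_monomial_eq_top h₀ h₂).ge, fun x => Module.Basis.mk_apply _ _ x⟩
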